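/- Let $0<\beta<1/2$, $0\le\theta\le 1$, and let $K$ be measurable on $(0,1)$ with $0<K_m\le K\le K_M<\infty$ almost everywhere. For $w\in L^2(0,1)$ let $$ {}^l I^\beta_x w=\frac1{\Gamma(\beta)}\int_0^x\frac{w(s)}{(x-s)^{1-\beta}}\,ds,\qquad {}^r I^\beta_x w=\frac1{\Gamma(\beta)}\int_x^1\frac{w(s)}{(s-x)^{1-\beta}}\,ds,\qquad I^\beta_\theta w(x)=\theta\,{}^l I^\beta_x w+(1-\theta)\,{}^r I^\beta_x w .$$ For $\mu>0$ let $H^\mu_0(0,1)$ be the completion of $C_0^\infty(0,1)$ in the norm $\|w\|_{H^\mu}=(\|w\|_{L^2(\mathbb R)}^2+\||\omega|^\mu\mathcal F w\|_{L^2(\mathbb R)}^2)^{1/2}$ (with $\mathcal F$ the unitary Fourier transform and functions extended by zero), and let $H^{-1}(0,1)$ be the dual space of $H^1_0(0,1)$ with the dual norm. Write $D$ for the weak derivative on $(0,1)$, and for $u\in H^{1-\beta}_0(0,1)$, $v\in H^1_0(0,1)$ put $$A(u,v)=\int_0^1 K\,(D I^\beta_\theta u)\,(Dv)\,dx .$$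 Let $w_l\in H^1(0,1)$ be the weak solution of $(K\,Dw_l,Dv)_{L^2(0,1)}=0$ for all $v\in H^1_0(0,1)$ with $w_l(0)=1$, $w_l(1)=0$, and let $u_l\in H^{1-\beta}_0(0,1)$ be the solution of $$I^\beta_\theta u_l(x)-(1-\theta)\,({}^r I^\beta_0 u_l)\,(1-x)-\theta\,({}^l I^\beta_1 u_l)\,x=w_l(x)-(1-x),\qquad 0\le x\le 1 .$$ Assume the nondegeneracy condition $$1+\theta\,({}^l I^\beta_1 u_l)-(1-\theta)\,({}^r I^\beta_0 u_l)\neq 0 .$$ Then $I^\beta_\theta u\in H^1(0,1)$ for all $u\in H^{1-\beta}_0(0,1)$, so that $A$ is well defined; $A$ is a bounded bilinear form on $H^{1-\beta}_0(0,1)\times H^1_0(0,1)$; and there is a constant $\kappa>0$, depending only on $\beta$, $\theta$ and $K$, such that $$\inf_{w\in H^{1-\beta}_0(0,1)\setminus\{0\}}\ \sup_{v\in H^1_0(0,1)\setminus\{0\}}\frac{A(w,v)}{\|w\|_{H^{1-\beta}}\|v\|_{H^1}}\ge\kappa,\qquad \sup_{w\in H^{1-\beta}_0(0,1)}A(w,v)>0\quad\text{for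 all } v\in H^1_0(0,1)\setminus\{0\},$$ and for every $f\in H^{-1}(0,1)$ there is a unique $u\in H^{1-\beta}_0(0,1)$ with $A(u,v)=\langle f,v\rangle$ for all $v\in H^1_0(0,1)$, and it satisfies $\|u\|_{H^{1-\beta}}\le\kappa^{-1}\|f\|_{H^{-1}}$. -/

import Mathlib

open Set Filter Topology MeasureTheory
open scoped ENNReal FourierTransform ContDiff

/-- Test functions: real `C^∞` functions with compact support contained in `(0,1)`,
regarded as functions on the line (extended by zero). -/
structure IsTest (φ : ℝ → ℝ) : Prop where
  smooth : ContDiff ℝ ∞ φ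
  compact : HasCompactSupport φ
  supp : tsupport φ ⊆ Ioo (0 : ℝ) 1

theorem IsTest.integrable {φ : ℝ → ℝ} (h : IsTest φ) :
    Integrable (fun x => (φ x : ℂ)) volume :=
  (h.smooth.continuous.integrable_of_hasCompactSupport h.compact).ofReal

theorem IsTest.zero : IsTest 0 :=
  ⟨contDiff_const, HasCompactSupport.zero, by simp [tsupport]⟩

theorem IsTest.add {φ ψ : ℝ → ℝ} (h : IsTest φ) (k : IsTest ψ) : IsTest (φ + ψ) :=
  ⟨h.smooth.add k.smooth, h.compact.add k.compact,
    (tsupport_add φ ψ).trans (union_subset h.supp k.supp)⟩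

theorem IsTest.smul {φ : ℝ → ℝ} (c : ℝ) (h : IsTest φ) : IsTest (c • φ) :=
  ⟨contDiff_const.smul h.smooth, h.compact.smul_left,
    (tsupport_smul_subset_right (fun _ => c) φ).trans h.supp⟩

/-- The function `ω ↦ |ω|^s (F φ)(ω)`, with the angular frequency written `ω = 2πξ`. With this
normalisation its `L²(dξ)` norm is the seminorm `‖|ω|^s F φ‖_{L²(dω)}` for the unitary Fourier
transform `F φ (ω) = (2π)^{-1/2} ∫ e^{-iωx} φ(x) dx`; for `s = 1` it equals `‖φ'‖_{L²}`. -/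
noncomputable def weightedFourier (s : ℝ) (φ : ℝ → ℝ) (ξ : ℝ) : ℂ :=
  ((|2 * Real.pi * ξ| ^ s : ℝ) : ℂ) * 𝓕 (fun x : ℝ => (φ x : ℂ)) ξ

/-- The Hilbert space `L²(ℝ; ℝ) × L²(ℝ; ℂ)` with norm `(‖w‖² + ‖g‖²)^{1/2}`. -/
abbrev L2Pair : Type := WithLp 2 (Lp ℝ 2 (volume : Measure ℝ) × Lp ℂ 2 (volume : Measure ℝ))

/-- The space `C_0^∞(0,1)` with the norm `‖φ‖_{H^s(ℝ)} = (‖φ‖² + ‖|ω|^s F φ‖²)^{1/2}`, realised by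
the isometric embedding `φ ↦ (φ, |ω|^s F φ)` in `L2Pair`. -/
noncomputable def testSpace (s : ℝ) : Submodule ℝ L2Pair where
  carrier := {p | ∃ φ : ℝ → ℝ, IsTest φ ∧ p.fst =ᵐ[volume] φ ∧
    p.snd =ᵐ[volume] weightedFourier s φ}
  zero_mem' := by
    refine ⟨0, IsTest.zero, Lp.coeFn_zero ℝ 2 volume, ?_⟩
    refine (Lp.coeFn_zero ℂ 2 volume).trans (Eventually.of_forall fun ξ => ?_)
    simp [weightedFourier, Real.fourier_eq]
  add_mem' := by
    rintro p q ⟨φ, hφ, h1, h2⟩ ⟨ψ, hψ, k1, k2⟩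
    refine ⟨φ + ψ, hφ.add hψ, (Lp.coeFn_add p.fst q.fst).trans (h1.add k1), ?_⟩
    refine ((Lp.coeFn_add p.snd q.snd).trans (h2.add k2)).trans
      (Eventually.of_forall fun ξ => ?_)
    have e : (fun x : ℝ => (((φ + ψ) x : ℝ) : ℂ)) = (fun x => (φ x : ℂ)) + fun x => (ψ x : ℂ) := by
      ext x; simp
    simp only [Pi.add_apply, weightedFourier]
    rw [← mul_add]
    congr 1
    have := VectorFourier.fourierIntegral_add Real.continuous_fourierChar
      (L := innerₗ ℝ) continuous_inner hφ.integrable hψ.integrable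
    have := congrFun this ξ
    simp only [Pi.add_apply] at this
    simp only [Complex.ofReal_add]
    exact this.symm
  smul_mem' := by
    rintro c p ⟨φ, hφ, h1, h2⟩
    refine ⟨c • φ, hφ.smul c, (Lp.coeFn_smul c p.fst).trans (h1.const_smul c), ?_⟩
    refine ((Lp.coeFn_smul c p.snd).trans (h2.const_smul c)).trans
      (Eventually.of_forall fun ξ => ?_)
    simp only [Pi.smul_apply, weightedFourier, Real.fourier_eq, smul_eq_mul,
      Complex.ofReal_mul, Complex.real_smul]
    rw [mul_left_comm]
    congr 1
    rw [← integral_const_mul]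
    congr 1
    ext x
    simp only [Circle.smul_def, smul_eq_mul]
    ring

/-- `H^s_0(0,1)`: the completion of `C_0^∞(0,1)` in the norm of `H^s(ℝ)`, realised as a closure.
An element `u` is a pair: `u.1.fst` is the underlying function, an element of `L²(ℝ)` vanishing
outside `(0,1)`, and `u.1.snd` is `|ω|^s F(u.1.fst)`, which `u.1.fst` determines. -/
abbrev H0 (s : ℝ) : Type := (testSpace s).topologicalClosure

/-- The function underlying an element of `H^s_0(0,1)`. -/
noncomputable def H0.fn {s : ℝ} (u : H0 s) : ℝ → ℝ := u.1.fst

/-- `g` is the weak derivative of `w` on `(0,1)`. -/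
def HasWeakDeriv (w g : ℝ → ℝ) : Prop :=
  LocallyIntegrableOn w (Ioo (0 : ℝ) 1) ∧ LocallyIntegrableOn g (Ioo (0 : ℝ) 1) ∧
    ∀ φ : ℝ → ℝ, IsTest φ →
      ∫ x in Ioo (0 : ℝ) 1, w x * deriv φ x = -∫ x in Ioo (0 : ℝ) 1, g x * φ x

open Classical in
/-- The weak derivative `D w` on `(0,1)`, unique up to null sets (zero if there is none). -/
noncomputable def weakDeriv (w : ℝ → ℝ) : ℝ → ℝ :=
  if h : ∃ g, HasWeakDeriv w g then h.choose else 0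

/-- `w` belongs to the Sobolev space `H^1(0,1)`. -/
def MemH1 (w : ℝ → ℝ) : Prop :=
  MemLp w 2 (volume.restrict (Ioo (0 : ℝ) 1)) ∧
    ∃ g, HasWeakDeriv w g ∧ MemLp g 2 (volume.restrict (Ioo (0 : ℝ) 1))

/-- The left fractional integral of order `σ` from `0`, evaluated at `x`. -/
noncomputable def leftInt (σ : ℝ) (w : ℝ → ℝ) (x : ℝ) : ℝ :=
  1 / Real.Gamma σ * ∫ s in Ioo 0 x, w s / (x - s) ^ (1 - σ)

/-- The right fractional integral of order `σ` up to `1`, evaluated at `x`. -/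
noncomputable def rightInt (σ : ℝ) (w : ℝ → ℝ) (x : ℝ) : ℝ :=
  1 / Real.Gamma σ * ∫ s in Ioo x 1, w s / (s - x) ^ (1 - σ)

/-- The two-sided fractional integral `I^β_θ`. -/
noncomputable def twoSidedInt (β θ : ℝ) (w : ℝ → ℝ) (x : ℝ) : ℝ :=
  θ * leftInt β w x + (1 - θ) * rightInt β w x

/-- The Petrov–Galerkin form `A(u,v) = (K D I^β_θ u, D v)_{L²(0,1)}`. -/
noncomputable def pgForm (K : ℝ → ℝ) (β θ : ℝ) (u : H0 (1 - β)) (v : H0 1) : ℝ :=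
  ∫ x in Ioo (0 : ℝ) 1, K x * weakDeriv (twoSidedInt β θ u.fn) x * weakDeriv v.fn x

/-- `w` (in its continuous representative) is the weak solution `w ∈ H^1(0,1)` of `(K w')' = 0`
in `(0,1)` with `w(0) = 1` and `w(1) = 0`. -/
structure IsLeftHarmonic (K w : ℝ → ℝ) : Prop where
  memH1 : MemH1 w
  cont : ContinuousOn w (Icc 0 1)
  at_zero : w 0 = 1
  at_one : w 1 = 0
  weak : ∀ v : H0 1, ∫ x in Ioo (0 : ℝ) 1, K x * weakDeriv w x * weakDeriv v.fn x = 0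

/-- `u` solves
`I^β_θ u - (1-θ) (I_r u)(0) (1-x) - θ (I_l u)(1) x = w(x) - (1-x)` on `[0,1]`. -/
def IsCorrector (β θ : ℝ) (w : ℝ → ℝ) (u : H0 (1 - β)) : Prop :=
  ∀ x ∈ Icc (0 : ℝ) 1,
    twoSidedInt β θ u.fn x - (1 - θ) * rightInt β u.fn 0 * (1 - x) - θ * leftInt β u.fn 1 * x
      = w x - (1 - x)

/-- The nondegeneracy condition `1 + θ (I_l u_l)(1) - (1-θ) (I_r u_l)(0) ≠ 0`, where `w_l` is the
left `K`-harmonic function and `u_l` the function of `H^{1-β}_0(0,1)` determined by `w_l`. -/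
def Nondegenerate (K : ℝ → ℝ) (β θ : ℝ) : Prop :=
  ∀ (wl : ℝ → ℝ) (ul : H0 (1 - β)), IsLeftHarmonic K wl → IsCorrector β θ wl ul →
    1 + θ * leftInt β ul.fn 1 - (1 - θ) * rightInt β ul.fn 0 ≠ 0

/-! Write T = D I^β_θ : H^{1-β}_0 → L²(0,1) and G = D : H^1_0 → L²(0,1). Then A(u,v) = (K T u, G v),
and the claim that A induces an isomorphism of H^{1-β}_0 onto the dual of H^1_0 becomes a question
about the ranges of T and G. By Poincaré and du Bois-Reymond, G is an isomorphism onto the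
orthogonal complement of the constants (`exists_gradOp_eq`).

The range of T is a closed hyperplane too (`exists_normal_range_twoSidedOp`), for three reasons.
Lower bound: for a test function the left derivative vanishes for x ≤ 0 and the right one for x ≥ 1,
so their product over (0,1) is a product over the whole line, and Plancherel gives cos(πβ) times the
squared seminorm (`inner_derivOp_one_neg_one`). Testing T u with the sum of the two derivatives
bounds T from below uniformly in θ, since cos(πβ) > 0 for β < 1/2. Codimension at most one: no G v ≠
0 is orthogonal to the range, by the energy identity for (D I^β φ, D φ)
(`eq_zero_of_forall_inner_twoSidedOp`). Codimension at least one: for θ = 1 the function (1-x)^{-β}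
is orthogonal to the range. If T were onto for some θ, the uniform lower bound would carry
surjectivity to θ = 1 by the method of continuity (`not_surjective_twoSidedOp`).

Now A(u,·) = 0 means that K T u is a constant c, that is T u = c/K. So if 1/K is not in the range of
T, the form is injective. It is then also surjective: if f = (y, G·), then y/K minus a suitable
multiple of 1/K lies in the range of T, and the constant so subtracted from y is invisible to G
(`bijective_pgOp`). If T u = 1/K had a solution, a multiple of it would be the corrector u_l and
would make the nondegeneracy expression vanish (`twoSidedOp_ne_of_nondegenerate`). The inf-sup
constant is obtained from the norm of the inverse, bounded by the open mapping theorem. -/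

/-! ### Laplace and Fourier representations of half-line fractional integrals -/

/-- The Laplace transform of `y ^ (a - 1)` on the right half plane. -/
theorem integral_rpow_mul_cexp_neg_mul_Ioi {a : ℝ} (ha : 0 < a) {z : ℂ} (hz : 0 < z.re) :
    ∫ y in Ioi (0 : ℝ), ((y ^ (a - 1) : ℝ) : ℂ) * Complex.exp (-(z * y))
      = z ^ (-(a : ℂ)) * (Real.Gamma a : ℝ) := by
  set U : Set ℂ := {z | 0 < z.re}
  have hUo : IsOpen U := isOpen_lt continuous_const Complex.continuous_re
  have hUc : IsPreconnected U := (convex_halfSpace_re_gt 0).isPreconnected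
  -- With respect to this density the integral is a complex moment generating function at -z, hence
  -- analytic on the half plane. Both sides agree on the positive reals, and the identity theorem
  -- does the rest.
  set ν : Measure ℝ := (volume.restrict (Ioi (0 : ℝ))).withDensity
    (fun y => ((y ^ (a - 1)).toNNReal : ℝ≥0∞))
  have hmeas : Measurable fun y : ℝ => (y ^ (a - 1)).toNNReal := by fun_prop
  have hset : ∀ t : ℝ, t < 0 → t ∈ ProbabilityTheory.integrableExpSet id ν := by
    intro t ht
    rw [ProbabilityTheory.integrableExpSet, mem_ofPred_eq,
      integrable_withDensity_iff_integrable_smul hmeas]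
    have h := Real.GammaIntegral_convergent ha
    have h2 := (integrableOn_Ioi_comp_mul_left_iff
      (fun x => Real.exp (-x) * x ^ (a - 1)) 0 (neg_pos.2 ht)).2 (by simpa using h)
    have h3 : IntegrableOn (fun y : ℝ => ((-t) ^ (a - 1))⁻¹ *
        (Real.exp (-(-t * y)) * (-t * y) ^ (a - 1))) (Ioi 0) := h2.const_mul _
    refine h3.congr_fun (fun y hy => ?_) measurableSet_Ioi
    have hy' : (0 : ℝ) < y := hy
    simp only [NNReal.smul_def, smul_eq_mul, id_eq]
    rw [Real.coe_toNNReal _ (by positivity), Real.mul_rpow (neg_pos.2 ht).le hy'.le]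
    have : (-t) ^ (a - 1) ≠ 0 := (Real.rpow_pos_of_pos (neg_pos.2 ht) _).ne'
    field_simp
  have hint : ∀ z : ℂ, z.re < 0 → z.re ∈ interior (ProbabilityTheory.integrableExpSet id ν) := by
    intro z hz
    have hs : Iio (0 : ℝ) ⊆ ProbabilityTheory.integrableExpSet id ν := fun t ht => hset t ht
    exact interior_mono hs (by rw [interior_Iio]; exact hz)
  have hF : DifferentiableOn ℂ (fun z => ProbabilityTheory.complexMGF id ν (-z)) U := by
    intro z hz
    have h1 := (ProbabilityTheory.hasDerivAt_complexMGF (hint (-z) (by simpa using! hz))).differentiableAt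
    exact (h1.comp z differentiableAt_id.neg).differentiableWithinAt
  have hG : DifferentiableOn ℂ (fun z : ℂ => z ^ (-(a : ℂ)) * (Real.Gamma a : ℝ)) U := by
    intro z hz
    refine DifferentiableAt.differentiableWithinAt ?_
    exact (differentiableAt_id.cpow_const (Or.inl hz)).mul_const _
  have hval : ∀ z : ℂ, ProbabilityTheory.complexMGF id ν (-z)
      = ∫ y in Ioi (0 : ℝ), ((y ^ (a - 1) : ℝ) : ℂ) * Complex.exp (-(z * y)) := by
    intro z
    rw [ProbabilityTheory.complexMGF, integral_withDensity_eq_integral_smul hmeas]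
    refine setIntegral_congr_fun measurableSet_Ioi (fun y hy => ?_)
    have hy' : (0 : ℝ) < y := hy
    simp only [NNReal.smul_def, id_eq]
    rw [Real.coe_toNNReal _ (by positivity)]
    simp
  have hreal : ∀ r : ℝ, 0 < r → ProbabilityTheory.complexMGF id ν (-(r : ℂ))
      = (r : ℂ) ^ (-(a : ℂ)) * (Real.Gamma a : ℝ) := by
    intro r hr
    rw [hval, ← Complex.ofReal_neg, ← Complex.ofReal_cpow hr.le, ← Complex.ofReal_mul]
    rw [Real.rpow_neg hr.le, ← Real.inv_rpow hr.le, ← one_div,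
      ← Real.integral_rpow_mul_exp_neg_mul_Ioi ha hr]
    rw [← integral_complex_ofReal]
    congr 1; ext y; push_cast; rfl
  have hfreq : ∃ᶠ z in 𝓝[≠] (1 : ℂ), ProbabilityTheory.complexMGF id ν (-z)
      = z ^ (-(a : ℂ)) * (Real.Gamma a : ℝ) := by
    have ht : Tendsto (fun r : ℝ => (r : ℂ)) (𝓝[≠] (1 : ℝ)) (𝓝[≠] (1 : ℂ)) := by
      refine tendsto_nhdsWithin_iff.2 ⟨?_, ?_⟩
      · exact (Complex.continuous_ofReal.tendsto' 1 1 (by simp)).mono_left nhdsWithin_le_nhds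
      · filter_upwards [self_mem_nhdsWithin] with r hr
        simpa using! hr
    refine ht.frequently (Eventually.frequently ?_)
    filter_upwards [nhdsWithin_le_nhds (lt_mem_nhds (zero_lt_one' ℝ))] with r hr
    exact hreal r hr
  have := (hF.analyticOnNhd hUo).eqOn_of_preconnected_of_frequently_eq (hG.analyticOnNhd hUo) hUc
    (by simp [U]) hfreq hz
  rw [← hval]; exact this

theorem integrable_indicator_const_mul_rpow {β : ℝ} (hβ : 0 < β) (M R : ℝ) :
    Integrable ((Ioc (0 : ℝ) R).indicator fun y => M * y ^ (β - 1)) := by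
  rw [integrable_indicator_iff measurableSet_Ioc]
  rcases le_or_gt 0 R with hR | hR
  · exact ((intervalIntegrable_iff_integrableOn_Ioc_of_le hR).1
      (intervalIntegral.intervalIntegrable_rpow' (by linarith))).const_mul M
  · simp [Ioc_eq_empty (not_lt.2 hR.le)]

/-- The majorant is uniform for |x| ≤ N, as differentiation under the integral sign requires. -/
theorem exists_norm_rpow_mul_comp_le {E : Type*} [NormedAddCommGroup E] {f : ℝ → E}
    (hf : Continuous f) (hc : HasCompactSupport f) {σ : ℝ} (hσ : |σ| = 1) (β N : ℝ) :
    ∃ M R : ℝ, ∀ x : ℝ, |x| ≤ N → ∀ y : ℝ, 0 < y →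
      y ^ (β - 1) * ‖f (x - σ * y)‖ ≤ (Ioc (0 : ℝ) R).indicator (fun y => M * y ^ (β - 1)) y := by
  obtain ⟨M, hM⟩ := hf.bounded_above_of_compact_support hc
  obtain ⟨R, hR⟩ := hc.isCompact.isBounded.subset_closedBall 0
  refine ⟨M, R + N, fun x hx y hy => ?_⟩
  by_cases h : y ≤ R + N
  · rw [indicator_of_mem (show y ∈ Ioc 0 (R + N) from ⟨hy, h⟩), mul_comm]
    gcongr
    exact hM _
  · rw [indicator_of_notMem (fun h' => h h'.2)]
    have : f (x - σ * y) = 0 := by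
      by_contra hne
      have h1 := hR (subset_tsupport f hne)
      rw [mem_closedBall_zero_iff, Real.norm_eq_abs] at h1
      have h2 : |σ * y| = y := by rw [abs_mul, hσ, one_mul, abs_of_pos hy]
      have h3 : |σ * y| ≤ |x - σ * y| + |x| := by
        have := abs_sub_abs_le_abs_sub (σ * y) x
        rw [abs_sub_comm] at this; linarith
      linarith
    simp [this]

theorem integrableOn_rpow_smul_comp {E : Type*} [NormedAddCommGroup E] [NormedSpace ℝ E]
    {f : ℝ → E} (hf : Continuous f) (hc : HasCompactSupport f) {σ β : ℝ} (hσ : |σ| = 1)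
    (hβ : 0 < β) (x : ℝ) :
    IntegrableOn (fun y : ℝ => y ^ (β - 1) • f (x - σ * y)) (Ioi 0) := by
  obtain ⟨M, R, h⟩ := exists_norm_rpow_mul_comp_le hf hc hσ β |x|
  refine (integrable_indicator_const_mul_rpow hβ M R).integrableOn.mono' ?_ ?_
  · exact ((by fun_prop : Measurable fun y : ℝ => y ^ (β - 1)).aestronglyMeasurable).smul
      (by fun_prop : Continuous fun y : ℝ => f (x - σ * y)).aestronglyMeasurable
  · filter_upwards [ae_restrict_mem measurableSet_Ioi] with y hy
    rw [norm_smul, Real.norm_of_nonneg (Real.rpow_nonneg (le_of_lt hy) _)]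
    exact h x le_rfl y hy

/-- A Fourier representation of fractional integrals over half lines. -/
theorem integral_rpow_mul_comp_eq_fourier {σ β : ℝ} (hσ : |σ| = 1) (hβ : 0 < β)
    (f : SchwartzMap ℝ ℂ) (hc : HasCompactSupport f)
    (hint : Integrable fun ξ : ℝ => |2 * Real.pi * ξ| ^ (-β) * ‖𝓕 f ξ‖) (x : ℝ) :
    ∫ y in Ioi (0 : ℝ), ((y ^ (β - 1) : ℝ) : ℂ) * f (x - σ * y)
      = (Real.Gamma β : ℝ) * ∫ ξ : ℝ, Complex.exp (2 * Real.pi * Complex.I * (ξ * x)) *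
        ((2 * Real.pi * ξ * σ * Complex.I) ^ (-(β : ℂ)) * 𝓕 f ξ) := by
  have hinv : ∀ t : ℝ, f t = ∫ ξ : ℝ, Complex.exp (2 * Real.pi * Complex.I * (ξ * t)) * 𝓕 f ξ := by
    intro t
    have h1 : 𝓕⁻ (𝓕 f) t = f t := by rw [FourierTransform.fourierInv_fourier_eq]
    rw [← h1, SchwartzMap.fourierInv_coe, Real.fourierInv_eq']
    congr 1; ext ξ
    simp only [smul_eq_mul]
    congr 2
    simp; ring
  -- The factor e^{-εy} makes the double integral absolutely convergent, so that Fubini applies, and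
  -- it moves the argument of the symbol into the open half plane where the Laplace formula holds.
  -- Both sides then pass to the limit ε → 0.
  have key : ∀ ε : ℝ, 0 < ε →
      ∫ y in Ioi (0 : ℝ), ((y ^ (β - 1) * Real.exp (-(ε * y)) : ℝ) : ℂ) * f (x - σ * y)
      = (Real.Gamma β : ℝ) * ∫ ξ : ℝ, Complex.exp (2 * Real.pi * Complex.I * (ξ * x)) *
        ((ε + 2 * Real.pi * ξ * σ * Complex.I) ^ (-(β : ℂ)) * 𝓕 f ξ) := by
    intro ε hε
    have hk : Integrable (fun y : ℝ => ((y ^ (β - 1) * Real.exp (-(ε * y)) : ℝ) : ℂ))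
        (volume.restrict (Ioi 0)) := by
      have h := integrableOn_rpow_mul_exp_neg_mul_rpow (p := 1) (s := β - 1) (b := ε)
        (by linarith) zero_lt_one hε
      have h' : IntegrableOn (fun y : ℝ => y ^ (β - 1) * Real.exp (-(ε * y))) (Ioi 0) := by
        simpa using h
      exact h'.ofReal
    calc _ = ∫ y in Ioi (0 : ℝ), ∫ ξ : ℝ, Complex.exp (2 * Real.pi * Complex.I * (ξ * (x - σ * y))) *
          (((y ^ (β - 1) * Real.exp (-(ε * y)) : ℝ) : ℂ) * 𝓕 f ξ) := by
          congr 1; ext y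
          rw [hinv, ← integral_const_mul]
          congr 1; ext ξ
          push_cast; ring
      _ = ∫ ξ : ℝ, ∫ y in Ioi (0 : ℝ), Complex.exp (2 * Real.pi * Complex.I * (ξ * (x - σ * y))) *
          (((y ^ (β - 1) * Real.exp (-(ε * y)) : ℝ) : ℂ) * 𝓕 f ξ) := by
          refine integral_integral_swap ?_
          refine (hk.mul_prod (𝓕 f).integrable).bdd_mul (c := 1) ?_ ?_
          · exact Continuous.aestronglyMeasurable (by fun_prop)
          · refine Eventually.of_forall fun p => ?_
            have : 2 * (Real.pi : ℂ) * Complex.I * ((p.2 : ℂ) * (x - σ * p.1))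
              = ((2 * Real.pi * (p.2 * (x - σ * p.1)) : ℝ) : ℂ) * Complex.I := by
              push_cast; ring
            rw [this, Complex.norm_exp_ofReal_mul_I]
      _ = _ := by
          rw [← integral_const_mul]
          congr 1; ext ξ
          have hz : 0 < ((ε : ℂ) + 2 * Real.pi * ξ * σ * Complex.I).re := by
            have : (ε : ℂ) + 2 * Real.pi * ξ * σ * Complex.I
              = (ε : ℂ) + ((2 * Real.pi * ξ * σ : ℝ) : ℂ) * Complex.I := by push_cast; ring
            rw [this]; simpa using hε
          have h1 := integral_rpow_mul_cexp_neg_mul_Ioi hβ hz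
          calc _ = ∫ y in Ioi (0 : ℝ), (Complex.exp (2 * Real.pi * Complex.I * (ξ * x)) * 𝓕 f ξ) *
                (((y ^ (β - 1) : ℝ) : ℂ) *
                  Complex.exp (-((ε + 2 * Real.pi * ξ * σ * Complex.I) * y))) := by
                congr 1; ext y
                have : Complex.exp (2 * Real.pi * Complex.I * (ξ * (x - σ * y)))
                    * ((Real.exp (-(ε * y)) : ℝ) : ℂ)
                  = Complex.exp (2 * Real.pi * Complex.I * (ξ * x)) *
                    Complex.exp (-((ε + 2 * Real.pi * ξ * σ * Complex.I) * y)) := by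
                  rw [Complex.ofReal_exp, ← Complex.exp_add, ← Complex.exp_add]
                  congr 1; push_cast; ring
                push_cast at this ⊢
                linear_combination ((y : ℝ) ^ (β - 1) : ℝ) * 𝓕 f ξ * this
            _ = _ := by rw [integral_const_mul, h1]; ring
  have hL : Tendsto (fun ε : ℝ =>
      ∫ y in Ioi (0 : ℝ), ((y ^ (β - 1) * Real.exp (-(ε * y)) : ℝ) : ℂ) * f (x - σ * y))
      (𝓝[>] 0) (𝓝 (∫ y in Ioi (0 : ℝ), ((y ^ (β - 1) : ℝ) : ℂ) * f (x - σ * y))) := by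
    refine tendsto_integral_filter_of_dominated_convergence
      (fun y => ‖y ^ (β - 1) • f (x - σ * y)‖) ?_ ?_
      (integrableOn_rpow_smul_comp f.continuous hc hσ hβ x).norm ?_
    · refine Eventually.of_forall fun ε => ?_
      have hf : Continuous fun y : ℝ => f (x - σ * y) := f.continuous.comp (by fun_prop)
      exact (Measurable.aestronglyMeasurable (by fun_prop)).mul hf.aestronglyMeasurable
    · filter_upwards [self_mem_nhdsWithin] with ε hε
      filter_upwards [ae_restrict_mem measurableSet_Ioi] with y hy
      have hy' : (0 : ℝ) < y := hy
      have hε' : (0 : ℝ) < ε := hε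
      rw [norm_mul, norm_smul, Complex.norm_real, norm_mul, Real.norm_of_nonneg (Real.exp_pos _).le]
      gcongr
      refine mul_le_of_le_one_right (norm_nonneg _) ?_
      rw [Real.exp_le_one_iff]
      have := mul_pos hε' hy'
      linarith
    · refine Eventually.of_forall fun y => ?_
      have : Continuous fun ε : ℝ =>
          ((y ^ (β - 1) * Real.exp (-(ε * y)) : ℝ) : ℂ) * f (x - σ * y) := by fun_prop
      exact (this.tendsto' 0 _ (by simp)).mono_left nhdsWithin_le_nhds
  have hR : Tendsto (fun ε : ℝ => ∫ ξ : ℝ, Complex.exp (2 * Real.pi * Complex.I * (ξ * x)) *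
        ((ε + 2 * Real.pi * ξ * σ * Complex.I) ^ (-(β : ℂ)) * 𝓕 f ξ)) (𝓝[>] 0)
      (𝓝 (∫ ξ : ℝ, Complex.exp (2 * Real.pi * Complex.I * (ξ * x)) *
        ((2 * Real.pi * ξ * σ * Complex.I) ^ (-(β : ℂ)) * 𝓕 f ξ))) := by
    have hcast : ∀ ε ξ : ℝ, (ε : ℂ) + 2 * Real.pi * ξ * σ * Complex.I
        = (ε : ℂ) + ((2 * Real.pi * ξ * σ : ℝ) : ℂ) * Complex.I := by
      intro ε ξ; push_cast; ring
    have hne : ∀ᵐ ξ : ℝ, ξ ≠ 0 := Measure.ae_ne volume 0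
    have habs : ∀ ξ : ℝ, |2 * Real.pi * ξ * σ| = |2 * Real.pi * ξ| := by
      intro ξ; rw [abs_mul, hσ, mul_one]
    refine tendsto_integral_filter_of_dominated_convergence _ ?_ ?_ hint ?_
    · refine Eventually.of_forall fun ε => ?_
      refine (Continuous.aestronglyMeasurable (by fun_prop)).mul
        (AEStronglyMeasurable.mul ?_ (𝓕 f).continuous.aestronglyMeasurable)
      exact Measurable.aestronglyMeasurable (by fun_prop)
    · filter_upwards [self_mem_nhdsWithin] with ε hε
      filter_upwards [hne] with ξ hξ
      have h1 : 2 * (Real.pi : ℂ) * Complex.I * ((ξ : ℂ) * x)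
          = ((2 * Real.pi * (ξ * x) : ℝ) : ℂ) * Complex.I := by push_cast; ring
      rw [norm_mul, h1, Complex.norm_exp_ofReal_mul_I, one_mul, norm_mul, ← Complex.ofReal_neg,
        Complex.norm_cpow_real]
      refine mul_le_mul_of_nonneg_right ?_ (norm_nonneg _)
      -- The real part ε only increases the modulus, so under the exponent -β the limit symbol is a
      -- majorant.
      refine Real.rpow_le_rpow_of_nonpos (by positivity) ?_ (neg_nonpos.2 hβ.le)
      · rw [← habs, hcast]
        have := Complex.abs_im_le_norm ((ε : ℂ) + ((2 * Real.pi * ξ * σ : ℝ) : ℂ) * Complex.I)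
        simpa using this
    · filter_upwards [hne] with ξ hξ
      refine Tendsto.const_mul _ (Tendsto.mul_const _ ?_)
      have hσ0 : σ ≠ 0 := by rintro rfl; simp at hσ
      have hs : (2 * Real.pi * ξ * σ * Complex.I : ℂ) ∈ Complex.slitPlane := by
        refine Or.inr ?_
        have : (2 * Real.pi * ξ * σ * Complex.I : ℂ)
          = ((2 * Real.pi * ξ * σ : ℝ) : ℂ) * Complex.I := by push_cast; ring
        rw [this]
        simp [hξ, hσ0, Real.pi_ne_zero]
      have hc : ContinuousAt (fun z : ℂ => z ^ (-(β : ℂ))) (2 * Real.pi * ξ * σ * Complex.I) :=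
        continuousAt_id.cpow continuousAt_const hs
      have hl : Tendsto (fun ε : ℝ => (ε : ℂ) + 2 * Real.pi * ξ * σ * Complex.I) (𝓝[>] 0)
          (𝓝 (2 * Real.pi * ξ * σ * Complex.I)) := by
        have : Continuous fun ε : ℝ => (ε : ℂ) + 2 * Real.pi * ξ * σ * Complex.I := by fun_prop
        exact (this.tendsto' 0 _ (by simp)).mono_left nhdsWithin_le_nhds
      exact hc.tendsto.comp hl
  refine tendsto_nhds_unique hL ?_
  refine (hR.const_mul _).congr' ?_
  filter_upwards [self_mem_nhdsWithin] with ε hε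
  exact (key ε hε).symm

/-! ### Bounded multipliers and the inverse Fourier transform on L² -/

theorem memLp_mul_of_ae_norm_le {α 𝕜 : Type*} [RCLike 𝕜] [MeasurableSpace α] {μ : Measure α}
    {m : α → 𝕜} {C : ℝ} (hm : AEStronglyMeasurable m μ) (hC : ∀ᵐ x ∂μ, ‖m x‖ ≤ C)
    (f : Lp 𝕜 2 μ) : MemLp (fun x => m x * f x) 2 μ :=
  (Lp.memLp f).of_le_mul (c := C) (hm.mul (Lp.aestronglyMeasurable f)) (by
    filter_upwards [hC] with x hx
    rw [norm_mul]
    exact mul_le_mul_of_nonneg_right hx (norm_nonneg _))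

/-- Multiplication by an essentially bounded function, as an operator on `L²`. -/
noncomputable def mulLp {α 𝕜 : Type*} [RCLike 𝕜] [MeasurableSpace α] {μ : Measure α} {m : α → 𝕜}
    {C : ℝ} (hm : AEStronglyMeasurable m μ) (hC : ∀ᵐ x ∂μ, ‖m x‖ ≤ C) :
    Lp 𝕜 2 μ →L[𝕜] Lp 𝕜 2 μ :=
  have hmem := memLp_mul_of_ae_norm_le hm hC
  LinearMap.mkContinuous
    { toFun := fun f => (hmem f).toLp
      map_add' := fun f g => by
        ext1
        filter_upwards [(hmem (f + g)).coeFn_toLp, (hmem f).coeFn_toLp, (hmem g).coeFn_toLp,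
          Lp.coeFn_add f g, Lp.coeFn_add (hmem f).toLp (hmem g).toLp] with x h1 h2 h3 h4 h5
        rw [h5, Pi.add_apply, h1, h2, h3, h4, Pi.add_apply, mul_add]
      map_smul' := fun c f => by
        ext1
        filter_upwards [(hmem (c • f)).coeFn_toLp, (hmem f).coeFn_toLp,
          Lp.coeFn_smul c f, Lp.coeFn_smul c (hmem f).toLp] with x h1 h2 h3 h4
        rw [RingHom.id_apply, h4, Pi.smul_apply, h1, h2, h3, Pi.smul_apply, smul_eq_mul,
          smul_eq_mul, mul_left_comm] }
    (max C 0) fun f => by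
      refine Lp.norm_le_mul_norm_of_ae_le_mul ?_
      filter_upwards [(hmem f).coeFn_toLp, hC] with x h1 h2
      simp only [LinearMap.coe_mk, AddHom.coe_mk]
      rw [h1, norm_mul]
      exact mul_le_mul_of_nonneg_right (h2.trans (le_max_left _ _)) (norm_nonneg _)

theorem coeFn_mulLp {α 𝕜 : Type*} [RCLike 𝕜] [MeasurableSpace α] {μ : Measure α} {m : α → 𝕜}
    {C : ℝ} (hm : AEStronglyMeasurable m μ) (hC : ∀ᵐ x ∂μ, ‖m x‖ ≤ C) (f : Lp 𝕜 2 μ) :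
    mulLp hm hC f =ᵐ[μ] fun x => m x * f x :=
  (memLp_mul_of_ae_norm_le hm hC f).coeFn_toLp

/-- On `L¹ ∩ L²`, the inverse Fourier transform on `L²` is given by the Fourier integral. -/
theorem coeFn_fourierInv_of_integrable (g : Lp ℂ 2 (volume : Measure ℝ)) (hg : Integrable g) :
    (𝓕⁻ g : Lp ℂ 2 (volume : Measure ℝ)) =ᵐ[volume] 𝓕⁻ (g : ℝ → ℂ) := by
  have hcont : Continuous (𝓕⁻ (g : ℝ → ℂ)) :=
    VectorFourier.fourierIntegral_continuous Real.continuous_fourierChar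
      (L := -innerₗ ℝ) (by simp only [LinearMap.neg_apply, innerₗ_apply_apply]; exact continuous_inner.neg) hg
  -- Both sides are locally integrable, so it suffices to pair them with test functions. There each
  -- transform can be moved onto the test function: by duality of tempered distributions for the L²
  -- one, by Fubini for the integral.
  refine ae_eq_of_integral_contDiff_smul_eq
    ((Lp.memLp _).locallyIntegrable (by norm_num)) hcont.locallyIntegrable ?_
  intro ψ hψ hc
  have hc' : HasCompactSupport fun x => (ψ x : ℂ) := hc.comp_left Complex.ofReal_zero
  set Ψ : SchwartzMap ℝ ℂ := hc'.toSchwartzMap (Complex.ofRealCLM.contDiff.comp hψ)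
  have h1 : ((𝓕⁻ g : Lp ℂ 2 (volume : Measure ℝ)) : TemperedDistribution ℝ ℂ) Ψ
      = (g : TemperedDistribution ℝ ℂ) (𝓕⁻ Ψ) := by
    rw [← Lp.fourierInv_toTemperedDistribution_eq]; rfl
  rw [Lp.toTemperedDistribution_apply, Lp.toTemperedDistribution_apply] at h1
  have h2 : ∫ x, (𝓕⁻ Ψ) x • g x = ∫ x, Ψ x • 𝓕⁻ (g : ℝ → ℂ) x := by
    have := VectorFourier.integral_fourierIntegral_smul_eq_flip (μ := volume) (ν := volume)
      Real.continuous_fourierChar (L := -innerₗ ℝ) (by simp only [LinearMap.neg_apply, innerₗ_apply_apply]; exact continuous_inner.neg)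
      Ψ.integrable hg
    rw [SchwartzMap.fourierInv_coe]
    refine this.trans ?_
    congr 1; ext x
    congr 2
    ext
    simp
  have h3 : ∀ h : ℝ → ℂ, ∫ x, ψ x • h x = ∫ x, Ψ x • h x := fun h => rfl
  rw [h3, h3, h1, h2]

/-! ### Test functions and the Fourier symbol of D I^β -/

namespace IsTest

theorem hasCompactSupport_ofReal {φ : ℝ → ℝ} (h : IsTest φ) :
    HasCompactSupport fun x => (φ x : ℂ) :=
  h.compact.comp_left Complex.ofReal_zero

theorem deriv {φ : ℝ → ℝ} (h : IsTest φ) : IsTest (deriv φ) :=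
  ⟨h.smooth.iterate_deriv 1, h.compact.deriv,
    (tsupport_deriv_subset (𝕜 := ℝ)).trans h.supp⟩

theorem eq_zero {φ : ℝ → ℝ} (h : IsTest φ) {x : ℝ} (hx : x ∉ Ioo (0 : ℝ) 1) : φ x = 0 := by
  by_contra hne
  exact hx (h.supp (subset_tsupport φ hne))

/-- A test function as a complex valued Schwartz function. -/
noncomputable def schwartz {φ : ℝ → ℝ} (h : IsTest φ) : SchwartzMap ℝ ℂ :=
  h.hasCompactSupport_ofReal.toSchwartzMap (Complex.ofRealCLM.contDiff.comp h.smooth)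

@[simp]
theorem schwartz_apply {φ : ℝ → ℝ} (h : IsTest φ) (x : ℝ) : h.schwartz x = φ x := rfl

theorem fourier_schwartz {φ : ℝ → ℝ} (h : IsTest φ) :
    ⇑(𝓕 h.schwartz : SchwartzMap ℝ ℂ) = 𝓕 fun x : ℝ => (φ x : ℂ) := rfl

theorem fourier_deriv {φ : ℝ → ℝ} (h : IsTest φ) (ξ : ℝ) :
    (𝓕 h.deriv.schwartz : SchwartzMap ℝ ℂ) ξ = 2 * Real.pi * ξ * Complex.I * 𝓕 (fun x : ℝ => (φ x : ℂ)) ξ := by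
  have hd : ∀ x, HasDerivAt (fun x : ℝ => (φ x : ℂ)) ((_root_.deriv φ x : ℝ) : ℂ) x := fun x =>
    ((h.smooth.differentiable (by simp)) x).hasDerivAt.ofReal_comp
  have hd' : _root_.deriv (fun x : ℝ => (φ x : ℂ)) = fun x => ((_root_.deriv φ x : ℝ) : ℂ) :=
    funext fun x => (hd x).deriv
  have := Real.fourier_deriv h.integrable (fun x => (hd x).differentiableAt)
    (by rw [hd']; exact h.deriv.integrable)
  rw [fourier_schwartz, ← hd', this]
  simp only [smul_eq_mul]
  ring

end IsTest

theorem memLp_abs_rpow_mul_schwartz {a : ℝ} (ha : 0 ≤ a) (g : SchwartzMap ℝ ℂ) (p : ℝ≥0∞) :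
    MemLp (fun ξ : ℝ => ((|2 * Real.pi * ξ| ^ a : ℝ) : ℂ) * g ξ) p volume := by
  obtain ⟨k, hk⟩ := exists_nat_ge a
  have htemp : Function.HasTemperateGrowth fun ξ : ℝ => (1 + ξ ^ 2) ^ k := by fun_prop
  set G : SchwartzMap ℝ ℂ := SchwartzMap.smulLeftCLM ℂ (fun ξ : ℝ => (1 + ξ ^ 2) ^ k) g
  have hG : ∀ ξ, G ξ = (((1 + ξ ^ 2) ^ k : ℝ)) • g ξ := fun ξ =>
    SchwartzMap.smulLeftCLM_apply_apply htemp g ξ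
  refine (G.memLp p volume).of_le_mul (c := (2 * Real.pi) ^ a) ?_ ?_
  · exact (Measurable.aestronglyMeasurable (by fun_prop)).mul g.continuous.aestronglyMeasurable
  · refine Eventually.of_forall fun ξ => ?_
    rw [hG, norm_mul, norm_smul, Complex.norm_real, ← mul_assoc]
    refine mul_le_mul_of_nonneg_right ?_ (norm_nonneg _)
    rw [Real.norm_of_nonneg (by positivity), Real.norm_of_nonneg (by positivity), abs_mul,
      abs_of_pos (by positivity : 0 < 2 * Real.pi), Real.mul_rpow (by positivity) (abs_nonneg _)]
    refine mul_le_mul_of_nonneg_left ?_ (by positivity)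
    have h1 : |ξ| ≤ 1 + ξ ^ 2 := by nlinarith [sq_nonneg (|ξ| - 1), sq_abs ξ, abs_nonneg ξ]
    calc |ξ| ^ a ≤ (1 + ξ ^ 2) ^ a := Real.rpow_le_rpow (abs_nonneg _) h1 ha
      _ ≤ (1 + ξ ^ 2) ^ (k : ℝ) := Real.rpow_le_rpow_of_exponent_le (by nlinarith [sq_nonneg ξ]) hk
      _ = _ := Real.rpow_natCast _ _

theorem memLp_weightedFourier {s : ℝ} (hs : 0 ≤ s) {φ : ℝ → ℝ} (h : IsTest φ) (p : ℝ≥0∞) :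
    MemLp (weightedFourier s φ) p volume :=
  memLp_abs_rpow_mul_schwartz hs (𝓕 h.schwartz) p

/-- The phase of the Fourier symbol of `D I^β`, for the left (`σ = 1`) and the right (`σ = -1`)
fractional integral; the modulus is `|2πξ|^(1-β)`. -/
noncomputable def phase (β σ ξ : ℝ) : ℂ :=
  (Real.cos (Real.pi * β / 2) - σ * (if 0 < ξ then 1 else -1) * Real.sin (Real.pi * β / 2)
    * Complex.I) * ((if 0 < ξ then 1 else -1) * Complex.I)

theorem measurable_phase (β σ : ℝ) : Measurable (phase β σ) := by
  have : Measurable fun ξ : ℝ => (if 0 < ξ then 1 else -1 : ℂ) :=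
    Measurable.ite measurableSet_Ioi measurable_const measurable_const
  unfold phase
  fun_prop

/-- Replacing σ by -σ conjugates the first factor of the phase, and the factors i sgn ξ cancel. What
remains is the square of cos(πβ/2) + iσ sgn(ξ) sin(πβ/2), whose real part does not depend on ξ. -/
theorem re_conj_phase_mul_phase {σ τ : ℝ} (hσ : |σ| = 1) (β : ℝ) (hτ : τ = -σ) (ξ : ℝ) :
    (starRingEnd ℂ (phase β σ ξ) * phase β τ ξ).re = Real.cos (Real.pi * β) := by
  have h2 : Real.cos (Real.pi * β) = 2 * Real.cos (Real.pi * β / 2) ^ 2 - 1 := by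
    rw [← Real.cos_two_mul]; congr 1; ring
  have h3 := Real.sin_sq_add_cos_sq (Real.pi * β / 2)
  have hσ' : σ ^ 2 = 1 := by rw [← sq_abs, hσ, one_pow]
  rw [h2, hτ]
  unfold phase
  generalize Real.cos (Real.pi * β / 2) = c at *
  generalize Real.sin (Real.pi * β / 2) = d at *
  split_ifs <;> simp <;> linear_combination (-d ^ 2) * hσ' - h3

/-- For order zero the phase is just i sgn ξ, which cancels the same factor in the other phase. -/
theorem re_conj_phase_zero_mul_phase (σ τ β ξ : ℝ) :
    (starRingEnd ℂ (phase β σ ξ) * phase 0 τ ξ).re = Real.cos (Real.pi * β / 2) := by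
  unfold phase
  generalize Real.cos (Real.pi * β / 2) = c at *
  generalize Real.sin (Real.pi * β / 2) = d at *
  split_ifs <;> simp

/-- With t = sgn ξ the base is |2πξ| · (σt i), and the principal power of the unit σt i = ±i is
e^{-σt iπβ/2}. -/
theorem cpow_mul_eq_phase {σ : ℝ} (hσ : |σ| = 1) (β : ℝ) {ξ : ℝ} (hξ : ξ ≠ 0) :
    (2 * Real.pi * ξ * σ * Complex.I : ℂ) ^ (-(β : ℂ)) * (2 * Real.pi * ξ * Complex.I)
      = phase β σ ξ * ((|2 * Real.pi * ξ| ^ (1 - β) : ℝ) : ℂ) := by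
  have hr : 0 < |2 * Real.pi * ξ| := abs_pos.2 (mul_ne_zero (by positivity) hξ)
  set t : ℝ := if 0 < ξ then 1 else -1 with ht
  have ht' : (if 0 < ξ then 1 else -1 : ℂ) = (t : ℂ) := by rw [ht]; split_ifs <;> simp
  have hξt : 2 * Real.pi * ξ = |2 * Real.pi * ξ| * t := by
    rw [ht, abs_mul, abs_of_pos (by positivity : 0 < 2 * Real.pi)]
    split_ifs with h
    · rw [abs_of_pos h, mul_one]
    · rw [abs_of_nonpos (not_lt.1 h)]; ring
  have hst : σ * t = 1 ∨ σ * t = -1 := by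
    have h1 : |σ * t| = 1 := by
      rw [abs_mul, hσ, ht]; split_ifs <;> simp
    rcases abs_eq zero_le_one |>.1 h1 with h | h <;> simp [h]
  have hξc : (2 * Real.pi * ξ : ℂ) = ((|2 * Real.pi * ξ| : ℝ) : ℂ) * t := by
    rw [← Complex.ofReal_mul, ← hξt]; push_cast; ring
  have hunit : ((σ * t : ℝ) * Complex.I : ℂ) ^ (-(β : ℂ))
      = Real.cos (Real.pi * β / 2) - ((σ * t : ℝ) : ℂ) * Real.sin (Real.pi * β / 2) * Complex.I := by
    have hne : ((σ * t : ℝ) * Complex.I : ℂ) ≠ 0 := by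
      rcases hst with h | h <;> simp [h]
    have hlog : Complex.log ((σ * t : ℝ) * Complex.I : ℂ)
        = ((σ * t : ℝ) : ℂ) * (Real.pi / 2 * Complex.I) := by
      rcases hst with h | h
      · rw [h]; simp [Complex.log_I]
      · rw [h]; simp [Complex.log_neg_I]
    rw [Complex.cpow_def_of_ne_zero hne, hlog]
    have : ((σ * t : ℝ) : ℂ) * (Real.pi / 2 * Complex.I) * -(β : ℂ)
        = ((-(σ * t) * (Real.pi * β / 2) : ℝ) : ℂ) * Complex.I := by push_cast; ring
    rw [this, Complex.exp_mul_I, ← Complex.ofReal_cos, ← Complex.ofReal_sin]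
    rcases hst with h | h <;> rw [h] <;> simp <;> ring
  have hz : (2 * Real.pi * ξ * σ * Complex.I : ℂ)
      = ((|2 * Real.pi * ξ| : ℝ) : ℂ) * ((σ * t : ℝ) * Complex.I) := by
    rw [hξc]; push_cast; ring
  have hne : ((σ * t : ℝ) * Complex.I : ℂ) ≠ 0 := by
    rcases hst with h | h <;> simp [h]
  have hmul : (2 * Real.pi * ξ * σ * Complex.I : ℂ) ^ (-(β : ℂ))
      = ((|2 * Real.pi * ξ| ^ (-β) : ℝ) : ℂ) * ((σ * t : ℝ) * Complex.I : ℂ) ^ (-(β : ℂ)) := by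
    rw [hz, Complex.cpow_def_of_ne_zero (mul_ne_zero (Complex.ofReal_ne_zero.2 hr.ne') hne),
      Complex.log_ofReal_mul hr hne, add_mul, Complex.exp_add,
      ← Complex.cpow_def_of_ne_zero hne, Complex.ofReal_cpow hr.le,
      Complex.cpow_def_of_ne_zero (Complex.ofReal_ne_zero.2 hr.ne'), Complex.ofReal_log hr.le]
    push_cast; rfl
  have hpow : |2 * Real.pi * ξ| ^ (1 - β) = |2 * Real.pi * ξ| ^ (-β) * |2 * Real.pi * ξ| := by
    rw [sub_eq_neg_add, Real.rpow_add hr, Real.rpow_one]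
  rw [hmul, hunit, phase, ht', hpow, hξc]
  push_cast
  ring

/-! ### Approximation by test functions and D I^β as a Fourier multiplier -/

/-- The fractional integral of order `β` over the half line to the left (`σ = 1`) or to the right
(`σ = -1`) of `x`. -/
noncomputable def fracInt (β σ : ℝ) (f : ℝ → ℝ) (x : ℝ) : ℝ :=
  1 / Real.Gamma β * ∫ y in Ioi (0 : ℝ), y ^ (β - 1) * f (x - σ * y)

/-- The element `p` of `L²(ℝ; ℝ) × L²(ℝ; ℂ)` is the image of the test function `φ`. -/
structure RepBy (s : ℝ) (p : L2Pair) (φ : ℝ → ℝ) : Prop where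
  test : IsTest φ
  fst : p.fst =ᵐ[volume] φ
  snd : p.snd =ᵐ[volume] weightedFourier s φ

theorem exists_repBy {s : ℝ} (hs : 0 ≤ s) {φ : ℝ → ℝ} (h : IsTest φ) :
    ∃ u : H0 s, RepBy s u.1 φ := by
  have h1 : MemLp φ 2 volume := h.smooth.continuous.memLp_of_hasCompactSupport h.compact
  have h2 := memLp_weightedFourier hs h 2
  have hp : RepBy s (WithLp.toLp 2 (h1.toLp, h2.toLp)) φ := ⟨h, h1.coeFn_toLp, h2.coeFn_toLp⟩
  exact ⟨⟨_, (testSpace s).le_topologicalClosure ⟨φ, hp.test, hp.fst, hp.snd⟩⟩, hp⟩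

theorem H0.exists_seq {s : ℝ} (u : H0 s) :
    ∃ (w : ℕ → H0 s) (φ : ℕ → ℝ → ℝ), (∀ n, RepBy s (w n).1 (φ n)) ∧
      Tendsto w atTop (𝓝 u) := by
  have hu : (u : L2Pair) ∈ closure (testSpace s : Set L2Pair) := u.2
  obtain ⟨p, hp, hlim⟩ := mem_closure_iff_seq_limit.1 hu
  choose φ h1 h2 h3 using hp
  refine ⟨fun n => ⟨p n, (testSpace s).le_topologicalClosure ⟨φ n, h1 n, h2 n, h3 n⟩⟩, φ,
    fun n => ⟨h1 n, h2 n, h3 n⟩, ?_⟩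
  exact tendsto_subtype_rng.2 hlim

/-- Density principle: identities and inequalities whose two sides are continuous in u need only be
checked on test functions, where everything is classical. -/
theorem H0.induction {s : ℝ} {P : H0 s → Prop} (hP : IsClosed {u | P u})
    (h : ∀ (u : H0 s) (φ : ℝ → ℝ), RepBy s u.1 φ → P u) (u : H0 s) : P u := by
  obtain ⟨w, φ, hw, hlim⟩ := u.exists_seq
  exact hP.mem_of_tendsto hlim (Eventually.of_forall fun n => h _ _ (hw n))

theorem norm_phase_le (β σ ξ : ℝ) : ‖phase β σ ξ‖ ≤ 1 + |σ| := by
  have h1 : ‖(if 0 < ξ then 1 else -1 : ℂ)‖ = 1 := by split_ifs <;> simp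
  unfold phase
  rw [norm_mul, norm_mul, h1, Complex.norm_I, mul_one, mul_one]
  refine (norm_sub_le _ _).trans (add_le_add ?_ ?_)
  · rw [Complex.norm_real]; exact Real.abs_cos_le_one _
  · rw [norm_mul, norm_mul, norm_mul, h1, Complex.norm_I, Complex.norm_real, Complex.norm_real,
      mul_one, mul_one]
    exact mul_le_of_le_one_right (abs_nonneg _) (Real.abs_sin_le_one _)

/-- Multiplication by the phase in `L²`. -/
noncomputable def phaseOp (β σ : ℝ) :
    Lp ℂ 2 (volume : Measure ℝ) →L[ℂ] Lp ℂ 2 (volume : Measure ℝ) :=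
  mulLp (measurable_phase β σ).aestronglyMeasurable (Eventually.of_forall (norm_phase_le β σ))

/-- The Fourier multiplier realising `D I^β` on the images of test functions. -/
noncomputable def fourierOp (β σ : ℝ) : L2Pair →L[ℝ] Lp ℂ 2 (volume : Measure ℝ) :=
  ((((Lp.fourierTransformₗᵢ ℝ ℂ).symm.toContinuousLinearEquiv :
      Lp ℂ 2 (volume : Measure ℝ) →L[ℂ] Lp ℂ 2 (volume : Measure ℝ)).comp
    (phaseOp β σ)).restrictScalars ℝ).comp (WithLp.sndL 2 ℝ _ _)

theorem fourierOp_apply (β σ : ℝ) (p : L2Pair) :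
    fourierOp β σ p = 𝓕⁻ (phaseOp β σ p.snd) := rfl

theorem coeFn_fourierOp {s : ℝ} (hs : 0 ≤ s) (β σ : ℝ) {p : L2Pair} {φ : ℝ → ℝ}
    (h : RepBy s p φ) :
    fourierOp β σ p =ᵐ[volume] fun x => ∫ ξ : ℝ,
      Complex.exp (2 * Real.pi * Complex.I * (ξ * x)) * (phase β σ ξ * weightedFourier s φ ξ) := by
  have h1 : phaseOp β σ p.snd =ᵐ[volume] fun ξ => phase β σ ξ * weightedFourier s φ ξ := by
    filter_upwards [coeFn_mulLp (measurable_phase β σ).aestronglyMeasurable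
      (Eventually.of_forall (norm_phase_le β σ)) p.snd, h.snd] with ξ h1 h2
    rw [phaseOp, h1, h2]
  have h2 : Integrable fun ξ => phase β σ ξ * weightedFourier s φ ξ :=
    (memLp_one_iff_integrable.1 (memLp_weightedFourier hs h.test 1)).bdd_mul
      (measurable_phase β σ).aestronglyMeasurable (Eventually.of_forall (norm_phase_le β σ))
  have h3 := coeFn_fourierInv_of_integrable (phaseOp β σ p.snd) (h2.congr h1.symm)
  filter_upwards [h3] with x hx
  rw [fourierOp_apply, hx, Real.fourierInv_congr_ae h1, Real.fourierInv_eq']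
  congr 1; ext ξ
  rw [smul_eq_mul]
  congr 2
  simp; ring

theorem ofReal_fracInt_deriv {β σ : ℝ} (hσ : |σ| = 1) (hβ0 : 0 < β) (hβ1 : β ≤ 1) {φ : ℝ → ℝ}
    (h : IsTest φ) (x : ℝ) :
    ((fracInt β σ (deriv φ) x : ℝ) : ℂ) = ∫ ξ : ℝ, Complex.exp (2 * Real.pi * Complex.I * (ξ * x)) *
      (phase β σ ξ * weightedFourier (1 - β) φ ξ) := by
  have hne : ∀ᵐ ξ : ℝ, ξ ≠ 0 := Measure.ae_ne volume 0
  have hint : Integrable fun ξ : ℝ =>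
      |2 * Real.pi * ξ| ^ (-β) * ‖(𝓕 h.deriv.schwartz : SchwartzMap ℝ ℂ) ξ‖ := by
    refine (memLp_one_iff_integrable.1
      (memLp_weightedFourier (sub_nonneg.2 hβ1) h 1)).norm.congr ?_
    filter_upwards [hne] with ξ hξ
    have hr : 0 < |2 * Real.pi * ξ| := abs_pos.2 (mul_ne_zero (by positivity) hξ)
    have e : ‖(2 * Real.pi * ξ : ℂ)‖ = |2 * Real.pi * ξ| := by
      rw [← Complex.ofReal_ofNat, ← Complex.ofReal_mul, ← Complex.ofReal_mul, Complex.norm_real,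
        Real.norm_eq_abs]
    rw [h.fourier_deriv, weightedFourier, norm_mul, norm_mul, norm_mul, Complex.norm_I, mul_one, e,
      Complex.norm_real, Real.norm_of_nonneg (by positivity), ← mul_assoc, sub_eq_neg_add,
      Real.rpow_add hr, Real.rpow_one]
  have key := integral_rpow_mul_comp_eq_fourier hσ hβ0 h.deriv.schwartz
    h.deriv.hasCompactSupport_ofReal hint x
  have hΓ : (Real.Gamma β : ℂ) ≠ 0 := Complex.ofReal_ne_zero.2 (Real.Gamma_pos_of_pos hβ0).ne'
  have e1 : (∫ y in Ioi (0 : ℝ), ((y ^ (β - 1) : ℝ) : ℂ) * h.deriv.schwartz (x - σ * y))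
      = ((∫ y in Ioi (0 : ℝ), y ^ (β - 1) * deriv φ (x - σ * y) : ℝ) : ℂ) := by
    rw [← integral_complex_ofReal]
    congr 1; ext y
    simp
  rw [e1] at key
  rw [fracInt, Complex.ofReal_mul, key, ← mul_assoc]
  push_cast
  rw [one_div, inv_mul_cancel₀ hΓ, one_mul]
  refine integral_congr_ae ?_
  filter_upwards [hne] with ξ hξ
  rw [h.fourier_deriv, weightedFourier]
  linear_combination Complex.exp (2 * Real.pi * Complex.I * (ξ * x)) *
    𝓕 (fun x : ℝ => (φ x : ℂ)) ξ * cpow_mul_eq_phase hσ β hξ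

theorem coeFn_fourierOp_eq_fracInt {β σ : ℝ} (hσ : |σ| = 1) (hβ0 : 0 < β) (hβ1 : β ≤ 1)
    {p : L2Pair} {φ : ℝ → ℝ} (h : RepBy (1 - β) p φ) :
    fourierOp β σ p =ᵐ[volume] fun x => ((fracInt β σ (deriv φ) x : ℝ) : ℂ) := by
  filter_upwards [coeFn_fourierOp (sub_nonneg.2 hβ1) β σ h] with x hx
  rw [hx, ofReal_fracInt_deriv hσ hβ0 hβ1 h.test]

/-- At order zero the modulus |ω| and the phase i sgn ω combine to iω, so the same multiplier also
gives the ordinary derivative. -/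
theorem coeFn_fourierOp_zero (σ : ℝ) {p : L2Pair} {φ : ℝ → ℝ} (h : RepBy 1 p φ) :
    fourierOp 0 σ p =ᵐ[volume] fun x => ((deriv φ x : ℝ) : ℂ) := by
  filter_upwards [coeFn_fourierOp zero_le_one 0 σ h] with x hx
  have h1 : 𝓕⁻ (𝓕 h.test.deriv.schwartz) x = h.test.deriv.schwartz x := by
    rw [FourierTransform.fourierInv_fourier_eq]
  rw [hx, ← h.test.deriv.schwartz_apply, ← h1, SchwartzMap.fourierInv_coe, Real.fourierInv_eq']
  congr 1; ext ξ
  rw [smul_eq_mul, h.test.fourier_deriv]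
  have e : phase 0 σ ξ * ((|2 * Real.pi * ξ| : ℝ) : ℂ) = 2 * Real.pi * ξ * Complex.I := by
    unfold phase
    rw [abs_mul, abs_of_pos (by positivity : 0 < 2 * Real.pi)]
    split_ifs with hξ
    · rw [abs_of_pos hξ]; simp; ring
    · rw [abs_of_nonpos (not_lt.1 hξ)]; simp; ring
  rw [weightedFourier, Real.rpow_one, ← mul_assoc (phase 0 σ ξ), e]
  congr 2
  simp; ring

theorem norm_sq_fst_of_repBy {s : ℝ} {p : L2Pair} {φ : ℝ → ℝ} (h : RepBy s p φ) :
    ‖p.fst‖ ^ 2 = ∫ x, φ x ^ 2 := by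
  rw [← real_inner_self_eq_norm_sq, L2.inner_def]
  refine integral_congr_ae ?_
  filter_upwards [h.fst] with x hx
  rw [real_inner_self_eq_norm_sq, hx, Real.norm_eq_abs, sq_abs]

theorem norm_sq_snd_of_repBy {s : ℝ} {p : L2Pair} {φ : ℝ → ℝ} (h : RepBy s p φ) :
    ‖p.snd‖ ^ 2 = ∫ ξ, ‖weightedFourier s φ ξ‖ ^ 2 := by
  have h1 : ‖p.snd‖ ^ 2 = (inner ℂ p.snd p.snd).re := by
    rw [inner_self_eq_norm_sq_to_K]; norm_cast
  rw [h1, L2.inner_def]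
  have h2 := integral_re (L2.integrable_inner (𝕜 := ℂ) p.snd p.snd)
  simp only [RCLike.re_eq_complex_re] at h2
  rw [← h2]
  refine integral_congr_ae ?_
  filter_upwards [h.snd] with x hx
  rw [hx, inner_self_eq_norm_sq_to_K]
  norm_cast

/-! ### Fractional Poincaré inequality -/

/-- A Poincaré inequality for the fractional seminorms on test functions. -/
theorem IsTest.integral_sq_le {r : ℝ} (hr : 0 ≤ r) {φ : ℝ → ℝ} (h : IsTest φ) :
    ∫ x, φ x ^ 2 ≤ 2 * ∫ ξ, ‖weightedFourier r φ ξ‖ ^ 2 := by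
  set N := ∫ x, φ x ^ 2 with hN
  set F : ℝ → ℂ := 𝓕 fun x : ℝ => (φ x : ℂ) with hF
  have hplanch : ∫ ξ, ‖F ξ‖ ^ 2 = N := by
    have := SchwartzMap.integral_norm_sq_fourier h.schwartz
    rw [h.fourier_schwartz] at this
    rw [hF, this, hN]
    congr 1; ext x; simp
  have hφ2 : MemLp φ 2 volume := h.smooth.continuous.memLp_of_hasCompactSupport h.compact
  have hφ1 : Integrable φ := h.smooth.continuous.integrable_of_hasCompactSupport h.compact
  -- The support lies in an interval of length one, so |F| ≤ ‖φ‖_{L¹} ≤ ‖φ‖_{L²}. The second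
  -- inequality is the nonnegativity of the variance of |φ|.
  have hsup : ∀ ξ, ‖F ξ‖ ^ 2 ≤ N := by
    intro ξ
    have h1 : ‖F ξ‖ ≤ ∫ x, |φ x| := by
      have := VectorFourier.norm_fourierIntegral_le_integral_norm Real.fourierChar volume
        (innerₗ ℝ) (fun x : ℝ => (φ x : ℂ)) ξ
      simpa using! this
    have h2 : ∫ x, |φ x| = ∫ x in Ioo (0 : ℝ) 1, |φ x| :=
      (setIntegral_eq_integral_of_forall_compl_eq_zero fun x hx => by
        rw [h.eq_zero hx, abs_zero]).symm
    have h3 : ∫ x, φ x ^ 2 = ∫ x in Ioo (0 : ℝ) 1, φ x ^ 2 :=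
      (setIntegral_eq_integral_of_forall_compl_eq_zero fun x hx => by
        rw [h.eq_zero hx]; simp).symm
    set a := ∫ x in Ioo (0 : ℝ) 1, |φ x| with ha
    have h4 : 0 ≤ ∫ x in Ioo (0 : ℝ) 1, (|φ x| - a) ^ 2 :=
      integral_nonneg fun x => sq_nonneg _
    have h5 : ∫ x in Ioo (0 : ℝ) 1, (|φ x| - a) ^ 2 = (∫ x in Ioo (0 : ℝ) 1, φ x ^ 2) - a ^ 2 := by
      have i1 : IntegrableOn (fun x => φ x ^ 2) (Ioo 0 1) := hφ2.integrable_sq.integrableOn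
      have i2 : IntegrableOn (fun x => 2 * a * |φ x|) (Ioo 0 1) :=
        (hφ1.norm.const_mul (2 * a)).integrableOn
      have i3 : IntegrableOn (fun _ : ℝ => a ^ 2) (Ioo 0 1) := by simp
      calc _ = ∫ x in Ioo (0 : ℝ) 1, (φ x ^ 2 - 2 * a * |φ x| + a ^ 2) := by
            congr 1; ext x; rw [sub_sq, sq_abs]; ring
        _ = _ := by
            have i12 : IntegrableOn (fun x => φ x ^ 2 - 2 * a * |φ x|) (Ioo 0 1) := i1.sub i2
            rw [integral_add i12 i3, integral_sub i1 i2, integral_const_mul, ← ha]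
            simp; ring
    calc ‖F ξ‖ ^ 2 ≤ a ^ 2 := by gcongr; exact h1.trans h2.le
      _ ≤ N := by rw [hN, h3]; linarith
  have hF2 : Integrable fun ξ => ‖F ξ‖ ^ 2 :=
    ((𝓕 h.schwartz).memLp 2 volume).integrable_norm_pow (by norm_num)
  have hw2 : Integrable fun ξ => ‖weightedFourier r φ ξ‖ ^ 2 :=
    (memLp_weightedFourier hr h 2).integrable_norm_pow (by norm_num)
  -- The window |ξ| ≤ 1/4 has length 1/2, so the low frequencies contribute at most N/2, which is
  -- absorbed on the left and produces the factor 2. Outside it 2π|ξ| > 1, and the weight is at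
  -- least one.
  have hind : Integrable ((Icc (-(1 / 4) : ℝ) (1 / 4)).indicator fun _ => N) :=
    (integrable_indicator_iff measurableSet_Icc).2 (by simp)
  have hle : ∀ ξ, ‖F ξ‖ ^ 2 ≤ (Icc (-(1 / 4) : ℝ) (1 / 4)).indicator (fun _ => N) ξ
      + ‖weightedFourier r φ ξ‖ ^ 2 := by
    intro ξ
    by_cases hξ : ξ ∈ Icc (-(1 / 4) : ℝ) (1 / 4)
    · rw [indicator_of_mem hξ]
      have := hsup ξ
      have := sq_nonneg ‖weightedFourier r φ ξ‖
      linarith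
    · rw [indicator_of_notMem hξ, zero_add, weightedFourier]
      gcongr
      rw [norm_mul, Complex.norm_real]
      refine le_mul_of_one_le_left (norm_nonneg _) ?_
      rw [Real.norm_of_nonneg (by positivity)]
      refine Real.one_le_rpow ?_ hr
      have h1 : 1 / 4 < |ξ| := by
        rw [mem_Icc, ← abs_le, not_le] at hξ; exact hξ
      rw [abs_mul, abs_of_pos (by positivity : 0 < 2 * Real.pi)]
      nlinarith [Real.pi_gt_three]
  have := integral_mono hF2 (hind.add hw2) hle
  rw [hplanch] at this
  simp only [Pi.add_apply] at this
  rw [integral_add hind hw2, integral_indicator measurableSet_Icc] at this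
  simp at this
  linarith

theorem norm_sq_fst_le {s : ℝ} (hs : 0 ≤ s) (u : H0 s) : ‖u.1.fst‖ ^ 2 ≤ 2 * ‖u.1.snd‖ ^ 2 := by
  have c1 : Continuous fun u : H0 s => u.1.fst :=
    (WithLp.fstL 2 ℝ _ _).continuous.comp continuous_subtype_val
  have c2 : Continuous fun u : H0 s => u.1.snd :=
    (WithLp.sndL 2 ℝ _ _).continuous.comp continuous_subtype_val
  refine H0.induction (P := fun u => ‖u.1.fst‖ ^ 2 ≤ 2 * ‖u.1.snd‖ ^ 2)
    (isClosed_le (by fun_prop) (by fun_prop)) (fun u φ h => ?_) u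
  rw [norm_sq_fst_of_repBy h, norm_sq_snd_of_repBy h]
  exact h.test.integral_sq_le hs

theorem norm_sq_le_snd {s : ℝ} (hs : 0 ≤ s) (u : H0 s) : ‖u‖ ^ 2 ≤ 3 * ‖u.1.snd‖ ^ 2 := by
  have h1 : ‖u‖ ^ 2 = ‖u.1.fst‖ ^ 2 + ‖u.1.snd‖ ^ 2 := by
    exact WithLp.prod_norm_sq_eq_of_L2 u.1
  have := norm_sq_fst_le hs u
  linarith

/-! ### Derivative operators into L²(0,1) and their quadratic identities -/

/-- The real Hilbert space `L²(0,1)`. -/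
abbrev L2Unit : Type := Lp ℝ 2 (volume.restrict (Ioo (0 : ℝ) 1))

theorem re_inner_fourierOp (β σ γ τ : ℝ) (p q : L2Pair) :
    (inner ℂ (fourierOp β σ p) (fourierOp γ τ q)).re
      = ∫ ξ, (starRingEnd ℂ (phase β σ ξ) * phase γ τ ξ
          * (starRingEnd ℂ (p.snd ξ) * q.snd ξ)).re := by
  have h1 : inner ℂ (fourierOp β σ p) (fourierOp γ τ q)
      = inner ℂ (phaseOp β σ p.snd) (phaseOp γ τ q.snd) :=
    (Lp.fourierTransformₗᵢ ℝ ℂ).symm.inner_map_map _ _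
  have h2 := integral_re (L2.integrable_inner (𝕜 := ℂ) (phaseOp β σ p.snd) (phaseOp γ τ q.snd))
  simp only [RCLike.re_eq_complex_re] at h2
  rw [h1, L2.inner_def, ← h2]
  refine integral_congr_ae ?_
  filter_upwards [coeFn_mulLp (measurable_phase β σ).aestronglyMeasurable
      (Eventually.of_forall (norm_phase_le β σ)) p.snd,
    coeFn_mulLp (measurable_phase γ τ).aestronglyMeasurable
      (Eventually.of_forall (norm_phase_le γ τ)) q.snd] with ξ e1 e2
  rw [phaseOp, phaseOp, e1, e2, RCLike.inner_apply, map_mul]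
  congr 1
  ring

theorem re_inner_eq_integral_of_ae {f g : Lp ℂ 2 (volume : Measure ℝ)} {a b : ℝ → ℝ}
    (hf : f =ᵐ[volume] fun x => (a x : ℂ)) (hg : g =ᵐ[volume] fun x => (b x : ℂ)) :
    (inner ℂ f g).re = ∫ x, a x * b x := by
  have h2 := integral_re (L2.integrable_inner (𝕜 := ℂ) f g)
  simp only [RCLike.re_eq_complex_re] at h2
  rw [L2.inner_def, ← h2]
  refine integral_congr_ae ?_
  filter_upwards [hf, hg] with x e1 e2
  rw [e1, e2, RCLike.inner_apply, Complex.conj_ofReal, ← Complex.ofReal_mul, Complex.ofReal_re,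
    mul_comm]

/-- The operator `D I^β` from (the image of) `H^{1-β}_0(0,1)` to `L²(0,1)`, for the left (`σ = 1`)
or right (`σ = -1`) fractional integral; for `β = 0` the weak derivative. -/
noncomputable def derivOp (β σ : ℝ) : L2Pair →L[ℝ] L2Unit :=
  ((Complex.reCLM.compLpL 2 (volume.restrict (Ioo (0 : ℝ) 1))).comp
    (LpToLpRestrictCLM ℝ ℂ ℝ volume 2 (Ioo (0 : ℝ) 1))).comp (fourierOp β σ)

theorem coeFn_derivOp_of_ae {β σ : ℝ} {p : L2Pair} {f : ℝ → ℝ}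
    (h : fourierOp β σ p =ᵐ[volume] fun x => (f x : ℂ)) :
    derivOp β σ p =ᵐ[volume.restrict (Ioo (0 : ℝ) 1)] f := by
  filter_upwards [Complex.reCLM.coeFn_compLpL (p := 2) (μ := volume.restrict (Ioo (0 : ℝ) 1))
      (LpToLpRestrictCLM ℝ ℂ ℝ volume 2 (Ioo (0 : ℝ) 1) (fourierOp β σ p)),
    LpToLpRestrictCLM_coeFn ℝ (Ioo (0 : ℝ) 1) (fourierOp β σ p), ae_restrict_of_ae h]
    with x h1 h2 h3
  refine h1.trans ?_
  rw [h2, h3]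
  simp

theorem coeFn_derivOp {β σ : ℝ} (hσ : |σ| = 1) (hβ0 : 0 < β) (hβ1 : β ≤ 1)
    {p : L2Pair} {φ : ℝ → ℝ} (h : RepBy (1 - β) p φ) :
    derivOp β σ p =ᵐ[volume.restrict (Ioo (0 : ℝ) 1)] fracInt β σ (deriv φ) :=
  coeFn_derivOp_of_ae (coeFn_fourierOp_eq_fracInt hσ hβ0 hβ1 h)

theorem coeFn_derivOp_zero (σ : ℝ) {p : L2Pair} {φ : ℝ → ℝ} (h : RepBy 1 p φ) :
    derivOp 0 σ p =ᵐ[volume.restrict (Ioo (0 : ℝ) 1)] deriv φ :=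
  coeFn_derivOp_of_ae (coeFn_fourierOp_zero σ h)

theorem inner_eq_integral_of_ae {f g : L2Unit} {a b : ℝ → ℝ}
    (hf : f =ᵐ[volume.restrict (Ioo (0 : ℝ) 1)] a) (hg : g =ᵐ[volume.restrict (Ioo (0 : ℝ) 1)] b) :
    inner ℝ f g = ∫ x in Ioo (0 : ℝ) 1, a x * b x := by
  rw [L2.inner_def]
  refine integral_congr_ae ?_
  filter_upwards [hf, hg] with x e1 e2
  rw [e1, e2, RCLike.inner_apply, conj_trivial, mul_comm]

theorem fracInt_one_eq_zero {β : ℝ} {f : ℝ → ℝ} (h : IsTest f) {x : ℝ} (hx : x ≤ 0) :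
    fracInt β 1 f x = 0 := by
  rw [fracInt, setIntegral_eq_zero_of_forall_eq_zero, mul_zero]
  intro y hy
  have hy' : (0 : ℝ) < y := hy
  rw [h.eq_zero, mul_zero]
  intro h'
  have := h'.1
  linarith

theorem fracInt_neg_one_eq_zero {β : ℝ} {f : ℝ → ℝ} (h : IsTest f) {x : ℝ} (hx : 1 ≤ x) :
    fracInt β (-1) f x = 0 := by
  rw [fracInt, setIntegral_eq_zero_of_forall_eq_zero, mul_zero]
  intro y hy
  have hy' : (0 : ℝ) < y := hy
  rw [h.eq_zero, mul_zero]
  intro h'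
  have := h'.2
  linarith

theorem continuous_snd_H0 {s : ℝ} : Continuous fun u : H0 s => u.1.snd :=
  (WithLp.sndL 2 ℝ _ _).continuous.comp continuous_subtype_val

/-- The product of the left and right fractional derivatives controls the seminorm. -/
theorem inner_derivOp_one_neg_one {β : ℝ} (hβ0 : 0 < β) (hβ1 : β ≤ 1) (u : H0 (1 - β)) :
    inner ℝ (derivOp β 1 u.1) (derivOp β (-1) u.1) = Real.cos (Real.pi * β) * ‖u.1.snd‖ ^ 2 := by
  have c2 := continuous_snd_H0 (s := 1 - β)
  have c3 : ∀ σ, Continuous fun u : H0 (1 - β) => derivOp β σ u.1 := fun σ =>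
    (derivOp β σ).continuous.comp continuous_subtype_val
  refine H0.induction (P := fun u => inner ℝ (derivOp β 1 u.1) (derivOp β (-1) u.1)
    = Real.cos (Real.pi * β) * ‖u.1.snd‖ ^ 2)
    (isClosed_eq ((c3 1).inner (c3 (-1))) (by fun_prop)) (fun u φ h => ?_) u
  have h1 : |(1 : ℝ)| = 1 := abs_one
  have h2 : |(-1 : ℝ)| = 1 := by simp
  rw [inner_eq_integral_of_ae (coeFn_derivOp h1 hβ0 hβ1 h) (coeFn_derivOp h2 hβ0 hβ1 h),
    setIntegral_eq_integral_of_forall_compl_eq_zero,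
    ← re_inner_eq_integral_of_ae (coeFn_fourierOp_eq_fracInt h1 hβ0 hβ1 h)
      (coeFn_fourierOp_eq_fracInt h2 hβ0 hβ1 h), re_inner_fourierOp, norm_sq_snd_of_repBy h,
    ← integral_const_mul]
  · refine integral_congr_ae ?_
    filter_upwards [h.snd] with ξ hξ
    rw [← re_conj_phase_mul_phase h1 β rfl ξ, hξ, ← Complex.normSq_eq_conj_mul_self,
      Complex.re_mul_ofReal, Complex.normSq_eq_norm_sq]
  -- One factor vanishes for x ≤ 0 and the other for x ≥ 1, so nothing is lost by passing from (0,1)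
  -- to the line. Only the mixed product has this property, not the square of either derivative.
  · intro x hx
    rcases le_or_gt x 0 with h0 | h0
    · rw [fracInt_one_eq_zero h.test.deriv h0, zero_mul]
    · rw [fracInt_neg_one_eq_zero h.test.deriv (not_lt.1 fun h' => hx ⟨h0, h'⟩), mul_zero]

/-- The energy identity for the form `(D I^β φ, D φ)`. -/
theorem inner_derivOp_deriv {β σ τ : ℝ} (hσ : |σ| = 1) (hβ0 : 0 < β) (hβ1 : β ≤ 1)
    {p q : L2Pair} {φ : ℝ → ℝ} (h : RepBy (1 - β) p φ) (k : RepBy 1 q φ) :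
    inner ℝ (derivOp β σ p) (derivOp 0 τ q)
      = Real.cos (Real.pi * β / 2) * ∫ ξ, ‖weightedFourier (1 - β / 2) φ ξ‖ ^ 2 := by
  rw [inner_eq_integral_of_ae (coeFn_derivOp hσ hβ0 hβ1 h) (coeFn_derivOp_zero τ k),
    setIntegral_eq_integral_of_forall_compl_eq_zero (fun x hx => by
      rw [h.test.deriv.eq_zero hx, mul_zero]),
    ← re_inner_eq_integral_of_ae (coeFn_fourierOp_eq_fracInt hσ hβ0 hβ1 h)
      (coeFn_fourierOp_zero τ k), re_inner_fourierOp, ← integral_const_mul]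
  refine integral_congr_ae ?_
  filter_upwards [h.snd, k.snd, Measure.ae_ne volume 0] with ξ h1 h2 hξ
  have hr : 0 < |2 * Real.pi * ξ| := abs_pos.2 (mul_ne_zero (by positivity) hξ)
  -- The orders 1-β and 1 have mean 1-β/2, the order of the energy seminorm.
  have hpow : |2 * Real.pi * ξ| ^ (1 - β + 1) = (|2 * Real.pi * ξ| ^ (1 - β / 2)) ^ 2 := by
    rw [← Real.rpow_natCast, ← Real.rpow_mul hr.le]
    congr 1
    push_cast; ring
  have e : starRingEnd ℂ (weightedFourier (1 - β) φ ξ) * weightedFourier 1 φ ξ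
      = ((‖weightedFourier (1 - β / 2) φ ξ‖ ^ 2 : ℝ) : ℂ) := by
    unfold weightedFourier
    rw [map_mul, Complex.conj_ofReal, mul_mul_mul_comm, ← Complex.ofReal_mul,
      ← Real.rpow_add hr, ← Complex.normSq_eq_conj_mul_self, Complex.normSq_eq_norm_sq,
      ← Complex.ofReal_mul, norm_mul, mul_pow, Complex.norm_real, Real.norm_of_nonneg (by positivity),
      hpow]
  rw [← re_conj_phase_zero_mul_phase σ τ β ξ, h1, h2, e, Complex.re_mul_ofReal]

/-! ### Classical calculus of fractional integrals of test functions -/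

theorem IsTest.hasDerivAt {φ : ℝ → ℝ} (h : IsTest φ) (x : ℝ) : HasDerivAt φ (_root_.deriv φ x) x :=
  (h.smooth.differentiable (by simp) x).hasDerivAt

theorem IsTest.continuous {φ : ℝ → ℝ} (h : IsTest φ) : Continuous φ := h.smooth.continuous

theorem hasDerivAt_fracInt {β σ : ℝ} (hσ : |σ| = 1) (hβ : 0 < β) {φ : ℝ → ℝ} (h : IsTest φ)
    (x : ℝ) : HasDerivAt (fracInt β σ φ) (fracInt β σ (deriv φ) x) x := by
  -- The radius |x| + 1 covers the unit ball around x in which the derivative is dominated.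
  obtain ⟨M, R, hb⟩ :=
    exists_norm_rpow_mul_comp_le h.deriv.continuous h.deriv.compact hσ β (|x| + 1)
  have hmeas : ∀ (f : ℝ → ℝ) (_ : Continuous f) (z : ℝ), AEStronglyMeasurable
      (fun y : ℝ => y ^ (β - 1) * f (z - σ * y)) (volume.restrict (Ioi 0)) := by
    intro f hf z
    exact (Measurable.aestronglyMeasurable (by fun_prop)).mul
      (by fun_prop : Continuous fun y : ℝ => f (z - σ * y)).aestronglyMeasurable
  have hint : Integrable (fun y : ℝ => y ^ (β - 1) * φ (x - σ * y)) (volume.restrict (Ioi 0)) :=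
    integrableOn_rpow_smul_comp h.continuous h.compact hσ hβ x
  refine HasDerivAt.const_mul (1 / Real.Gamma β) ?_
  refine (hasDerivAt_integral_of_dominated_loc_of_deriv_le (Metric.ball_mem_nhds x one_pos)
    (F' := fun z y => y ^ (β - 1) * deriv φ (z - σ * y))
    (Eventually.of_forall fun z => hmeas φ h.continuous z) hint
    (hmeas _ h.deriv.continuous x) ?_
    (integrable_indicator_const_mul_rpow hβ M R).integrableOn ?_).2
  · filter_upwards [ae_restrict_mem measurableSet_Ioi] with y hy z hz
    rw [norm_mul, Real.norm_of_nonneg (Real.rpow_nonneg (le_of_lt hy) _)]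
    refine hb z ?_ y hy
    have h1 := abs_sub_abs_le_abs_sub z x
    rw [Metric.mem_ball, Real.dist_eq] at hz
    linarith
  · refine Eventually.of_forall fun y z _ => ?_
    refine HasDerivAt.const_mul _ ?_
    have := (h.hasDerivAt (z - σ * y)).comp z ((hasDerivAt_id z).sub_const (σ * y))
    rw [mul_one] at this
    exact this

theorem integral_fracInt_deriv {β σ : ℝ} (hσ : |σ| = 1) (hβ : 0 < β) {φ : ℝ → ℝ} (h : IsTest φ)
    (a b : ℝ) : ∫ t in a..b, fracInt β σ (deriv φ) t = fracInt β σ φ b - fracInt β σ φ a := by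
  have hc : Continuous (fracInt β σ (deriv φ)) :=
    continuous_iff_continuousAt.2 fun x => (hasDerivAt_fracInt hσ hβ h.deriv x).continuousAt
  exact intervalIntegral.integral_eq_sub_of_hasDerivAt (fun x _ => hasDerivAt_fracInt hσ hβ h x)
    (hc.intervalIntegrable a b)

/-- The substitution s = x - y turns one integral into the other. The half line may be used because
the test function vanishes on (-∞, 0]. -/
theorem leftInt_eq_fracInt {β : ℝ} {φ : ℝ → ℝ} (h : IsTest φ) (x : ℝ) :
    leftInt β φ x = fracInt β 1 φ x := by
  have e1 : ∫ y in Ioi (0 : ℝ), y ^ (β - 1) * φ (x - 1 * y)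
      = ∫ s in Iio x, φ s / (x - s) ^ (1 - β) := by
    rw [← integral_indicator measurableSet_Ioi, ← integral_indicator measurableSet_Iio,
      ← integral_sub_left_eq_self
        ((Iio x).indicator fun s => φ s / (x - s) ^ (1 - β)) volume x]
    congr 1; ext y
    by_cases hy : 0 < y
    · rw [indicator_of_mem (show y ∈ Ioi 0 from hy),
        indicator_of_mem (show x - y ∈ Iio x from by simpa using hy), sub_sub_cancel, one_mul,
        div_eq_mul_inv, ← Real.rpow_neg hy.le, neg_sub, mul_comm]
    · rw [indicator_of_notMem (show y ∉ Ioi 0 from hy),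
        indicator_of_notMem (show x - y ∉ Iio x from by simpa using hy)]
  rw [leftInt, fracInt, e1]
  congr 1
  refine (setIntegral_eq_of_subset_of_forall_sdiff_eq_zero measurableSet_Iio Ioo_subset_Iio_self
    fun s hs => ?_).symm
  rw [h.eq_zero (fun h' => hs.2 ⟨h'.1, hs.1⟩), zero_div]

theorem rightInt_eq_fracInt {β : ℝ} {φ : ℝ → ℝ} (h : IsTest φ) (x : ℝ) :
    rightInt β φ x = fracInt β (-1) φ x := by
  have e1 : ∫ y in Ioi (0 : ℝ), y ^ (β - 1) * φ (x - (-1) * y)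
      = ∫ s in Ioi x, φ s / (s - x) ^ (1 - β) := by
    rw [← integral_indicator measurableSet_Ioi, ← integral_indicator measurableSet_Ioi,
      ← integral_add_left_eq_self
        ((Ioi x).indicator fun s => φ s / (s - x) ^ (1 - β)) x]
    congr 1; ext y
    by_cases hy : 0 < y
    · rw [indicator_of_mem (show y ∈ Ioi 0 from hy),
        indicator_of_mem (show x + y ∈ Ioi x from by simpa using hy), add_sub_cancel_left,
        div_eq_mul_inv, ← Real.rpow_neg hy.le, neg_sub, mul_comm, neg_one_mul, sub_neg_eq_add]
    · rw [indicator_of_notMem (show y ∉ Ioi 0 from hy),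
        indicator_of_notMem (show x + y ∉ Ioi x from by simpa using hy)]
  rw [rightInt, fracInt, e1]
  congr 1
  refine (setIntegral_eq_of_subset_of_forall_sdiff_eq_zero measurableSet_Ioi Ioo_subset_Ioi_self
    fun s hs => ?_).symm
  rw [h.eq_zero (fun h' => hs.2 ⟨hs.1, h'.2⟩), zero_div]

/-! ### Sup bound and continuity of point values of fractional integrals -/

theorem sq_integral_mul_le {α : Type*} [MeasurableSpace α] {μ : Measure α} {f g : α → ℝ}
    (hf : MemLp f 2 μ) (hg : MemLp g 2 μ) :
    (∫ x, f x * g x ∂μ) ^ 2 ≤ (∫ x, f x ^ 2 ∂μ) * ∫ x, g x ^ 2 ∂μ := by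
  have key : ∀ {f g : α → ℝ} (hf : MemLp f 2 μ) (hg : MemLp g 2 μ),
      inner ℝ hf.toLp hg.toLp = ∫ x, f x * g x ∂μ := by
    intro f g hf hg
    rw [L2.inner_def]
    refine integral_congr_ae ?_
    filter_upwards [hf.coeFn_toLp, hg.coeFn_toLp] with x e1 e2
    rw [e1, e2, RCLike.inner_apply, conj_trivial, mul_comm]
  have := real_inner_mul_inner_self_le hf.toLp hg.toLp
  rw [key, key, key] at this
  simpa only [sq] using this

/-- The embedding of `H^s` into the bounded functions, `1/2 < s ≤ 1`. -/
theorem exists_abs_le_of_repBy {s : ℝ} (hs : 1 / 2 < s) (hs1 : s ≤ 1) :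
    ∃ C : ℝ, 0 ≤ C ∧ ∀ (u : H0 s) (φ : ℝ → ℝ), RepBy s u.1 φ → ∀ x, |φ x| ≤ C * ‖u‖ := by
  set k : ℝ → ℝ := fun ξ => (1 + |ξ|) ^ (-s) with hk
  have hk2 : MemLp k 2 volume := by
    rw [memLp_two_iff_integrable_sq (Measurable.aestronglyMeasurable (by fun_prop))]
    have := integrable_one_add_norm (E := ℝ) (μ := volume) (r := 2 * s) (by simp; linarith)
    refine this.congr (Eventually.of_forall fun ξ => ?_)
    simp only [hk, Real.norm_eq_abs]
    rw [← Real.rpow_natCast, ← Real.rpow_mul (by positivity)]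
    congr 1; push_cast; ring
  refine ⟨√((∫ ξ, k ξ ^ 2) * 2), Real.sqrt_nonneg _, fun u φ h x => ?_⟩
  set F : ℝ → ℂ := 𝓕 fun x : ℝ => (φ x : ℂ) with hF
  set w := weightedFourier s φ with hw
  have hFm : ∀ p, MemLp F p volume := fun p => (𝓕 h.test.schwartz).memLp p volume
  have hwm : ∀ p, MemLp w p volume := fun p => memLp_weightedFourier (by linarith) h.test p
  have hplanch : ∫ ξ, ‖F ξ‖ ^ 2 = ∫ x, φ x ^ 2 := by
    have := SchwartzMap.integral_norm_sq_fourier h.test.schwartz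
    rw [h.test.fourier_schwartz] at this
    rw [hF, this]
    congr 1; ext x; simp
  have h1 : |φ x| ≤ ∫ ξ, ‖F ξ‖ := by
    have e : 𝓕⁻ (𝓕 h.test.schwartz) x = h.test.schwartz x := by
      rw [FourierTransform.fourierInv_fourier_eq]
    have e2 : ‖h.test.schwartz x‖ = |φ x| := by simp
    rw [← e2, ← e, SchwartzMap.fourierInv_coe]
    have := VectorFourier.norm_fourierIntegral_le_integral_norm Real.fourierChar volume
      (-innerₗ ℝ) F x
    simpa using! this
  -- This prepares Cauchy–Schwarz with the weight k, which is square integrable because 2s > 1.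
  -- Subadditivity of t ↦ t^s for s ≤ 1 gives (1+|ξ|)^s ≤ 1 + |2πξ|^s.
  have hpt : ∀ ξ, ‖F ξ‖ ≤ k ξ * (‖F ξ‖ + ‖w ξ‖) := by
    intro ξ
    have e1 : ‖w ξ‖ = |2 * Real.pi * ξ| ^ s * ‖F ξ‖ := by
      rw [hw, weightedFourier, norm_mul, Complex.norm_real, Real.norm_of_nonneg (by positivity)]
    have e2 : (1 + |ξ|) ^ s ≤ 1 + |2 * Real.pi * ξ| ^ s := by
      refine (Real.rpow_add_le_add_rpow zero_le_one (abs_nonneg ξ) (by linarith) hs1).trans ?_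
      have e4 : |ξ| ≤ |2 * Real.pi * ξ| := by
        rw [abs_mul, abs_of_pos (by positivity : 0 < 2 * Real.pi)]
        nlinarith [Real.pi_gt_three, abs_nonneg ξ]
      rw [Real.one_rpow]
      exact add_le_add_right (Real.rpow_le_rpow (abs_nonneg _) e4 (by linarith)) 1
    have e3 : 0 < (1 + |ξ|) ^ s := by positivity
    rw [e1, hk]
    simp only
    rw [Real.rpow_neg (by positivity), inv_mul_eq_div, le_div_iff₀ e3]
    nlinarith [norm_nonneg (F ξ)]
  have hsum : MemLp (fun ξ => ‖F ξ‖ + ‖w ξ‖) 2 volume := (hFm 2).norm.add (hwm 2).norm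
  have h2 : ∫ ξ, ‖F ξ‖ ≤ ∫ ξ, k ξ * (‖F ξ‖ + ‖w ξ‖) :=
    integral_mono (memLp_one_iff_integrable.1 (hFm 1)).norm (hk2.integrable_mul hsum) hpt
  have i1 := (hFm 2).integrable_norm_pow (by norm_num)
  have i2 := (hwm 2).integrable_norm_pow (by norm_num)
  have h3 : ∫ ξ, (‖F ξ‖ + ‖w ξ‖) ^ 2 ≤ 2 * ‖u‖ ^ 2 := by
    have e : ‖u‖ ^ 2 = ‖u.1.fst‖ ^ 2 + ‖u.1.snd‖ ^ 2 := WithLp.prod_norm_sq_eq_of_L2 u.1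
    rw [e, norm_sq_fst_of_repBy h, norm_sq_snd_of_repBy h, ← hplanch, ← integral_add i1 i2,
      ← integral_const_mul]
    refine integral_mono hsum.integrable_sq ((i1.add i2).const_mul 2) fun ξ => ?_
    simp only
    nlinarith [sq_nonneg (‖F ξ‖ - ‖w ξ‖)]
  have h4 := sq_integral_mul_le hk2 hsum
  have h0 : 0 ≤ ∫ ξ, k ξ ^ 2 := integral_nonneg fun ξ => sq_nonneg _
  rw [← Real.sqrt_sq (norm_nonneg u), ← Real.sqrt_mul (by positivity)]
  refine (h1.trans h2).trans (Real.le_sqrt_of_sq_le (h4.trans ?_))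
  rw [mul_assoc]
  gcongr

/-- Approximants converge in L², hence almost everywhere along a subsequence, and the uniform
pointwise bound survives the limit. -/
theorem exists_ae_abs_fn_le {s : ℝ} (hs : 1 / 2 < s) (hs1 : s ≤ 1) :
    ∃ C : ℝ, 0 ≤ C ∧ ∀ u : H0 s, ∀ᵐ x, |u.fn x| ≤ C * ‖u‖ := by
  obtain ⟨C, hC, h⟩ := exists_abs_le_of_repBy hs hs1
  refine ⟨C, hC, fun u => ?_⟩
  obtain ⟨w, φ, hw, hlim⟩ := u.exists_seq
  have hfst : Tendsto (fun n => (w n).1.fst) atTop (𝓝 u.1.fst) :=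
    (((WithLp.fstL 2 ℝ _ _).continuous.comp continuous_subtype_val).tendsto u).comp hlim
  obtain ⟨ns, hns, hae⟩ := (tendstoInMeasure_of_tendsto_Lp hfst).exists_seq_tendsto_ae
  have hall : ∀ᵐ x, ∀ n, (w n).1.fst x = φ n x := ae_all_iff.2 fun n => (hw n).fst
  filter_upwards [hae, hall] with x hx hx'
  refine le_of_tendsto_of_tendsto hx.abs ((hlim.norm.comp hns.tendsto_atTop).const_mul C)
    (Eventually.of_forall fun n => ?_)
  simp only [Function.comp_apply]
  rw [hx']
  exact h _ _ (hw _) x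

/-- The fractional kernels are integrable but, for β < 1/2, not square integrable. Continuity
therefore rests on the sup bound and not on Cauchy–Schwarz; 1-β > 1/2 makes that bound available. -/
theorem continuous_setIntegral_fn_mul {s : ℝ} (hs : 1 / 2 < s) (hs1 : s ≤ 1) {S : Set ℝ}
    {k : ℝ → ℝ} (hk : IntegrableOn k S) : Continuous fun u : H0 s => ∫ x in S, u.fn x * k x := by
  obtain ⟨C, hC, h⟩ := exists_ae_abs_fn_le hs hs1
  have hint : ∀ u : H0 s, IntegrableOn (fun x => u.fn x * k x) S := fun u =>
    hk.bdd_mul (c := C * ‖u‖) (Lp.aestronglyMeasurable u.1.fst).restrict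
      (ae_restrict_of_ae (h u))
  let T : H0 s →ₗ[ℝ] ℝ :=
    { toFun := fun u => ∫ x in S, u.fn x * k x
      map_add' := fun u v => by
        rw [← integral_add (hint u) (hint v)]
        refine integral_congr_ae (ae_restrict_of_ae ?_)
        filter_upwards [Lp.coeFn_add u.1.fst v.1.fst] with x hx
        have : (u + v).fn x = u.fn x + v.fn x := hx
        rw [this, add_mul]
      map_smul' := fun c u => by
        rw [RingHom.id_apply, smul_eq_mul, ← integral_const_mul]
        refine integral_congr_ae (ae_restrict_of_ae ?_)
        filter_upwards [Lp.coeFn_smul c u.1.fst] with x hx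
        have : (c • u).fn x = c * u.fn x := hx
        rw [this, mul_assoc] }
  have hT : ∀ u, ‖T u‖ ≤ (C * ∫ x in S, ‖k x‖) * ‖u‖ := by
    intro u
    refine (norm_integral_le_integral_norm _).trans ?_
    rw [mul_right_comm, ← integral_const_mul]
    refine integral_mono_ae (hint u).norm (hk.norm.const_mul _) (ae_restrict_of_ae ?_)
    filter_upwards [h u] with x hx
    rw [norm_mul]
    exact mul_le_mul_of_nonneg_right hx (norm_nonneg _)
  exact (T.mkContinuous _ hT).continuous

theorem continuous_leftInt {β : ℝ} (hβ0 : 0 < β) (hβ1 : β < 1 / 2) {x : ℝ} (hx : 0 ≤ x) :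
    Continuous fun u : H0 (1 - β) => leftInt β u.fn x := by
  have hk : IntegrableOn (fun s => ((x - s) ^ (1 - β))⁻¹) (Ioo 0 x) := by
    have h1 : IntervalIntegrable (fun s : ℝ => (x - s) ^ (β - 1)) volume 0 x := by
      have := ((intervalIntegral.intervalIntegrable_rpow' (a := 0) (b := x)
        (r := β - 1) (by linarith)).comp_sub_left x).symm
      simpa using this
    rw [intervalIntegrable_iff_integrableOn_Ioo_of_le hx] at h1
    refine h1.congr_fun (fun s hs => ?_) measurableSet_Ioo
    simp only
    rw [← Real.rpow_neg (sub_nonneg.2 hs.2.le), neg_sub]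
  simpa only [leftInt, div_eq_mul_inv] using
    (continuous_setIntegral_fn_mul (by linarith) (by linarith) hk).const_mul (1 * (Real.Gamma β)⁻¹)

theorem continuous_rightInt {β : ℝ} (hβ0 : 0 < β) (hβ1 : β < 1 / 2) {x : ℝ} (hx : x ≤ 1) :
    Continuous fun u : H0 (1 - β) => rightInt β u.fn x := by
  have hk : IntegrableOn (fun s => ((s - x) ^ (1 - β))⁻¹) (Ioo x 1) := by
    have h1 : IntervalIntegrable (fun s : ℝ => (s - x) ^ (β - 1)) volume x 1 := by
      have := (intervalIntegral.intervalIntegrable_rpow' (a := 0) (b := 1 - x)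
        (r := β - 1) (by linarith)).comp_sub_right x
      simpa using this
    rw [intervalIntegrable_iff_integrableOn_Ioo_of_le hx] at h1
    refine h1.congr_fun (fun s hs => ?_) measurableSet_Ioo
    simp only
    rw [← Real.rpow_neg (sub_nonneg.2 hs.1.le), neg_sub]
  simpa only [rightInt, div_eq_mul_inv] using
    (continuous_setIntegral_fn_mul (by linarith) (by linarith) hk).const_mul (1 * (Real.Gamma β)⁻¹)

/-! ### Fractional integrals as primitives of L² functions -/

theorem L2Unit.integrableOn (f : L2Unit) : IntegrableOn f (Ioo 0 1) :=
  (Lp.memLp f).integrable (by norm_num)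

theorem L2Unit.intervalIntegrable (f : L2Unit) {a b : ℝ} (ha : a ∈ Icc (0 : ℝ) 1)
    (hb : b ∈ Icc (0 : ℝ) 1) : IntervalIntegrable f volume a b := by
  have h : IntervalIntegrable f volume 0 1 :=
    (intervalIntegrable_iff_integrableOn_Ioo_of_le zero_le_one).2 f.integrableOn
  refine h.mono_set ?_
  rw [uIcc_of_le zero_le_one]
  exact uIcc_subset_Icc ha hb

theorem setIntegral_Ioo_zero_one_indicator {f : ℝ → ℝ} {a b : ℝ} (ha : 0 ≤ a) (hab : a ≤ b)
    (hb : b ≤ 1) :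
    ∫ t in a..b, f t = ∫ t in Ioo a b, f t ∂(volume.restrict (Ioo (0 : ℝ) 1)) := by
  rw [intervalIntegral.integral_of_le hab, integral_Ioc_eq_integral_Ioo,
    Measure.restrict_restrict measurableSet_Ioo,
    inter_eq_left.2 (Ioo_subset_Ioo ha hb)]

theorem L2Unit.continuous_intervalIntegral {a b : ℝ} (ha : 0 ≤ a) (hab : a ≤ b) (hb : b ≤ 1) :
    Continuous fun f : L2Unit => ∫ t in a..b, f t := by
  have : (fun f : L2Unit => ∫ t in a..b, f t) = fun f : L2Unit =>
      inner ℝ (indicatorConstLp 2 (μ := volume.restrict (Ioo (0 : ℝ) 1))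
        (measurableSet_Ioo (a := a) (b := b)) (measure_ne_top _ _) (1 : ℝ)) f := by
    ext f
    rw [L2.inner_indicatorConstLp_one, setIntegral_Ioo_zero_one_indicator ha hab hb]
  rw [this]
  fun_prop

theorem intervalIntegral_congr_of_ae_restrict {f g : ℝ → ℝ} {a b : ℝ} (ha : 0 ≤ a) (hab : a ≤ b)
    (hb : b ≤ 1) (h : f =ᵐ[volume.restrict (Ioo (0 : ℝ) 1)] g) :
    ∫ t in a..b, f t = ∫ t in a..b, g t := by
  rw [setIntegral_Ioo_zero_one_indicator ha hab hb, setIntegral_Ioo_zero_one_indicator ha hab hb]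
  exact integral_congr_ae (ae_restrict_of_ae h)

theorem RepBy.fn_eq {s : ℝ} {u : H0 s} {φ : ℝ → ℝ} (h : RepBy s u.1 φ) : u.fn =ᵐ[volume] φ := h.fst

theorem leftInt_congr_ae {β : ℝ} {f g : ℝ → ℝ} (h : f =ᵐ[volume] g) (x : ℝ) :
    leftInt β f x = leftInt β g x := by
  unfold leftInt
  congr 1
  refine integral_congr_ae (ae_restrict_of_ae ?_)
  filter_upwards [h] with y hy
  rw [hy]

theorem rightInt_congr_ae {β : ℝ} {f g : ℝ → ℝ} (h : f =ᵐ[volume] g) (x : ℝ) :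
    rightInt β f x = rightInt β g x := by
  unfold rightInt
  congr 1
  refine integral_congr_ae (ae_restrict_of_ae ?_)
  filter_upwards [h] with y hy
  rw [hy]

/-- For test functions this is the fundamental theorem of calculus with zero value at x = 0, and
both sides are continuous in u. It is the link between the Fourier multiplier and the integral that
defines I^β. -/
theorem leftInt_eq_integral_derivOp {β : ℝ} (hβ0 : 0 < β) (hβ1 : β < 1 / 2) (u : H0 (1 - β))
    {x : ℝ} (hx : x ∈ Icc (0 : ℝ) 1) :
    leftInt β u.fn x = ∫ t in (0 : ℝ)..x, derivOp β 1 u.1 t := by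
  refine H0.induction (P := fun u => leftInt β u.fn x = ∫ t in (0 : ℝ)..x, derivOp β 1 u.1 t)
    (isClosed_eq (continuous_leftInt hβ0 hβ1 hx.1)
      ((L2Unit.continuous_intervalIntegral le_rfl hx.1 hx.2).comp
        ((derivOp β 1).continuous.comp continuous_subtype_val))) (fun u φ h => ?_) u
  rw [leftInt_congr_ae h.fn_eq, leftInt_eq_fracInt h.test,
    intervalIntegral_congr_of_ae_restrict le_rfl hx.1 hx.2
      (coeFn_derivOp abs_one hβ0 (by linarith) h),
    integral_fracInt_deriv abs_one hβ0 h.test, fracInt_one_eq_zero h.test le_rfl, sub_zero]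

theorem rightInt_eq_integral_derivOp {β : ℝ} (hβ0 : 0 < β) (hβ1 : β < 1 / 2) (u : H0 (1 - β))
    {x : ℝ} (hx : x ∈ Icc (0 : ℝ) 1) :
    rightInt β u.fn x = -∫ t in x..1, derivOp β (-1) u.1 t := by
  have h2 : |(-1 : ℝ)| = 1 := by simp
  refine H0.induction (P := fun u => rightInt β u.fn x = -∫ t in x..1, derivOp β (-1) u.1 t)
    (isClosed_eq (continuous_rightInt hβ0 hβ1 hx.2)
      ((L2Unit.continuous_intervalIntegral hx.1 hx.2 le_rfl).comp
        ((derivOp β (-1)).continuous.comp continuous_subtype_val)).neg) (fun u φ h => ?_) u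
  rw [rightInt_congr_ae h.fn_eq, rightInt_eq_fracInt h.test,
    intervalIntegral_congr_of_ae_restrict hx.1 hx.2 le_rfl
      (coeFn_derivOp h2 hβ0 (by linarith) h),
    integral_fracInt_deriv h2 hβ0 h.test, fracInt_neg_one_eq_zero h.test le_rfl, zero_sub, neg_neg]

/-! ### Weak derivatives on (0,1) -/

theorem IsTest.memLp {φ : ℝ → ℝ} (h : IsTest φ) (p : ℝ≥0∞) (μ : Measure ℝ)
    [IsFiniteMeasureOnCompacts μ] : MemLp φ p μ :=
  h.continuous.memLp_of_hasCompactSupport h.compact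

/-- Primitives are absolutely continuous, so integration by parts applies. The boundary terms vanish
with φ, and the constant contributes c ∫ φ' = 0. -/
theorem hasWeakDeriv_of_primitive {w g : ℝ → ℝ} (hg : IntegrableOn g (Ioo 0 1)) {c : ℝ}
    (hw : ∀ x ∈ Ioo (0 : ℝ) 1, w x = c + ∫ t in (0 : ℝ)..x, g t) : HasWeakDeriv w g := by
  have hi : IntervalIntegrable g volume 0 1 :=
    (intervalIntegrable_iff_integrableOn_Ioo_of_le zero_le_one).2 hg
  have hP := hi.absolutelyContinuousOnInterval_intervalIntegral (c := 0) (by simp)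
  set P : ℝ → ℝ := fun x => ∫ t in (0 : ℝ)..x, g t
  have hcont : ContinuousOn (fun x => c + P x) (Icc 0 1) := by
    have := hP.continuousOn
    rw [uIcc_of_le zero_le_one] at this
    exact continuousOn_const.add this
  refine ⟨?_, hg.locallyIntegrableOn, fun φ hφ => ?_⟩
  · refine IntegrableOn.locallyIntegrableOn ?_
    refine ((hcont.integrableOn_Icc).mono_set Ioo_subset_Icc_self).congr_fun
      (fun x hx => (hw x hx).symm) measurableSet_Ioo
  · have hφac : AbsolutelyContinuousOnInterval φ 0 1 :=
      (hφ.smooth.of_le (by simp)).contDiffOn.absolutelyContinuousOnInterval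
    have e := hP.integral_mul_deriv_eq_deriv_mul hφac
    rw [hφ.eq_zero (x := 1) (by simp), hφ.eq_zero (x := 0) (by simp), mul_zero, mul_zero, sub_zero,
      zero_sub] at e
    have e2 : ∫ x in (0 : ℝ)..1, deriv P x * φ x = ∫ x in (0 : ℝ)..1, g x * φ x := by
      refine intervalIntegral.integral_congr_ae ?_
      filter_upwards [hi.ae_hasDerivAt_integral] with x hx hx'
      rw [(hx (uIoc_subset_uIcc hx') 0 (by simp)).deriv]
    have e3 : ∫ x in (0 : ℝ)..1, c * deriv φ x = 0 := by
      rw [intervalIntegral.integral_const_mul, intervalIntegral.integral_deriv_eq_sub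
        (fun x _ => (hφ.hasDerivAt x).differentiableAt) (hφ.deriv.continuous.intervalIntegrable _ _),
        hφ.eq_zero (x := 1) (by simp), hφ.eq_zero (x := 0) (by simp), sub_zero, mul_zero]
    rw [e2] at e
    simp only [← integral_Ioc_eq_integral_Ioo, ← intervalIntegral.integral_of_le zero_le_one]
    have e4 : ∫ x in (0 : ℝ)..1, w x * deriv φ x
        = (∫ x in (0 : ℝ)..1, P x * deriv φ x) + ∫ x in (0 : ℝ)..1, c * deriv φ x := by
      rw [← intervalIntegral.integral_add]
      · rw [intervalIntegral.integral_of_le zero_le_one, intervalIntegral.integral_of_le zero_le_one,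
          integral_Ioc_eq_integral_Ioo, integral_Ioc_eq_integral_Ioo]
        refine setIntegral_congr_fun measurableSet_Ioo fun x hx => ?_
        rw [hw x hx]
        ring
      · refine ContinuousOn.intervalIntegrable ?_
        exact hP.continuousOn.mul hφ.deriv.continuous.continuousOn
      · exact (continuous_const.mul hφ.deriv.continuous).intervalIntegrable _ _
    rw [e4, e3, add_zero, e]

theorem HasWeakDeriv.congr_ae {w w' g g' : ℝ → ℝ} (h : HasWeakDeriv w g)
    (hw : w =ᵐ[volume.restrict (Ioo (0 : ℝ) 1)] w') (hg : g =ᵐ[volume.restrict (Ioo (0 : ℝ) 1)] g') :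
    HasWeakDeriv w' g' := by
  have hloc : ∀ {f f' : ℝ → ℝ}, LocallyIntegrableOn f (Ioo (0 : ℝ) 1) →
      f =ᵐ[volume.restrict (Ioo (0 : ℝ) 1)] f' → LocallyIntegrableOn f' (Ioo (0 : ℝ) 1) := by
    intro f f' hf hff
    rw [locallyIntegrableOn_iff isOpen_Ioo.isLocallyClosed] at hf ⊢
    intro k hk hkc
    exact (hf k hk hkc).congr (ae_restrict_of_ae_restrict_of_subset hk hff)
  refine ⟨hloc h.1 hw, hloc h.2.1 hg, fun φ hφ => ?_⟩
  have e1 : ∫ x in Ioo (0 : ℝ) 1, w' x * deriv φ x = ∫ x in Ioo (0 : ℝ) 1, w x * deriv φ x :=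
    integral_congr_ae (by filter_upwards [hw] with x hx; rw [hx])
  have e2 : ∫ x in Ioo (0 : ℝ) 1, g' x * φ x = ∫ x in Ioo (0 : ℝ) 1, g x * φ x :=
    integral_congr_ae (by filter_upwards [hg] with x hx; rw [hx])
  rw [e1, e2, h.2.2 φ hφ]

theorem ae_eq_zero_of_forall_integral_mul_test {f : ℝ → ℝ}
    (hf : LocallyIntegrableOn f (Ioo (0 : ℝ) 1))
    (h : ∀ φ, IsTest φ → ∫ x in Ioo (0 : ℝ) 1, f x * φ x = 0) :
    f =ᵐ[volume.restrict (Ioo (0 : ℝ) 1)] 0 := by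
  refine (ae_restrict_iff' measurableSet_Ioo).2 ?_
  refine isOpen_Ioo.ae_eq_zero_of_integral_contDiff_smul_eq_zero hf fun φ h1 h2 h3 => ?_
  have hφ : IsTest φ := ⟨h1, h2, h3⟩
  rw [← h φ hφ, ← setIntegral_eq_integral_of_forall_compl_eq_zero (s := Ioo (0 : ℝ) 1)
    fun x hx => by rw [hφ.eq_zero hx, zero_smul]]
  congr 1; ext x
  rw [smul_eq_mul, mul_comm]

theorem LocallyIntegrableOn.integrableOn_mul_test {f φ : ℝ → ℝ}
    (hf : LocallyIntegrableOn f (Ioo (0 : ℝ) 1)) (h : IsTest φ) :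
    IntegrableOn (fun x => f x * φ x) (Ioo 0 1) := by
  have h1 : IntegrableOn (fun x => f x * φ x) (tsupport φ) := by
    have := hf.integrableOn_compact_subset h.supp h.compact
    exact this.mul_continuousOn h.continuous.continuousOn h.compact
  refine (integrableOn_iff_integrable_of_support_subset ?_).1 h1 |>.integrableOn
  exact (Function.support_mul_subset_right f φ).trans (subset_tsupport φ)

/-- Since `weakDeriv` is an arbitrary choice, this uniqueness is what makes integrals involving it
computable. -/
theorem HasWeakDeriv.ae_eq {w g g' : ℝ → ℝ} (h : HasWeakDeriv w g) (h' : HasWeakDeriv w g') :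
    g =ᵐ[volume.restrict (Ioo (0 : ℝ) 1)] g' := by
  have := ae_eq_zero_of_forall_integral_mul_test (h.2.1.sub h'.2.1) fun φ hφ => by
    have e := (h.2.2 φ hφ).symm.trans (h'.2.2 φ hφ)
    simp only [Pi.sub_apply, sub_mul]
    rw [integral_sub (LocallyIntegrableOn.integrableOn_mul_test h.2.1 hφ)
      (LocallyIntegrableOn.integrableOn_mul_test h'.2.1 hφ)]
    linarith
  filter_upwards [this] with x hx
  simpa [sub_eq_zero] using hx

theorem HasWeakDeriv.weakDeriv_ae_eq {w g : ℝ → ℝ} (h : HasWeakDeriv w g) :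
    weakDeriv w =ᵐ[volume.restrict (Ioo (0 : ℝ) 1)] g := by
  have hex : ∃ g, HasWeakDeriv w g := ⟨g, h⟩
  rw [weakDeriv, dif_pos hex]
  exact hex.choose_spec.ae_eq h

theorem continuous_integral_mul {α : Type*} [MeasurableSpace α] {μ : Measure α} {k : α → ℝ}
    (hk : MemLp k 2 μ) : Continuous fun f : Lp ℝ 2 μ => ∫ x, f x * k x ∂μ := by
  have : (fun f : Lp ℝ 2 μ => ∫ x, f x * k x ∂μ) = fun f => inner ℝ f hk.toLp := by
    ext f
    rw [L2.inner_def]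
    refine integral_congr_ae ?_
    filter_upwards [hk.coeFn_toLp] with x e
    rw [e, RCLike.inner_apply, conj_trivial, mul_comm]
  rw [this]
  fun_prop

theorem H0.memLp_fn {s : ℝ} (u : H0 s) : MemLp u.fn 2 volume := Lp.memLp u.1.fst

theorem hasWeakDeriv_derivOp_zero (v : H0 1) (τ : ℝ) : HasWeakDeriv v.fn (derivOp 0 τ v.1) := by
  refine ⟨(v.memLp_fn.locallyIntegrable (by norm_num)).locallyIntegrableOn _,
    (L2Unit.integrableOn _).locallyIntegrableOn, fun φ hφ => ?_⟩
  have e : ∀ v : H0 1, ∫ x in Ioo (0 : ℝ) 1, v.fn x * deriv φ x = ∫ x, v.1.fst x * deriv φ x :=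
    fun v => setIntegral_eq_integral_of_forall_compl_eq_zero fun x hx => by
      rw [hφ.deriv.eq_zero hx, mul_zero]
  refine H0.induction (P := fun v => ∫ x in Ioo (0 : ℝ) 1, v.fn x * deriv φ x
    = -∫ x in Ioo (0 : ℝ) 1, derivOp 0 τ v.1 x * φ x) ?_ (fun v ψ h => ?_) v
  · simp only [e]
    refine isClosed_eq ?_ ?_
    · exact (continuous_integral_mul (hφ.deriv.memLp 2 volume)).comp
        ((WithLp.fstL 2 ℝ _ _).continuous.comp continuous_subtype_val)
    · exact ((continuous_integral_mul (hφ.memLp 2 (volume.restrict (Ioo 0 1)))).comp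
        ((derivOp 0 τ).continuous.comp continuous_subtype_val)).neg
  · have hψ : HasWeakDeriv ψ (deriv ψ) := by
      refine hasWeakDeriv_of_primitive (c := 0)
        (h.test.deriv.continuous.integrable_of_hasCompactSupport h.test.deriv.compact).integrableOn
        fun x _ => ?_
      rw [intervalIntegral.integral_deriv_eq_sub
        (fun x _ => (h.test.hasDerivAt x).differentiableAt)
        (h.test.deriv.continuous.intervalIntegrable _ _), h.test.eq_zero (x := 0) (by simp)]
      ring
    exact (hψ.congr_ae (ae_restrict_of_ae h.fn_eq.symm) (coeFn_derivOp_zero τ h).symm).2.2 φ hφ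

theorem memH1_fn (v : H0 1) : MemH1 v.fn :=
  ⟨v.memLp_fn.restrict _, _, hasWeakDeriv_derivOp_zero v 1, Lp.memLp _⟩

theorem weakDeriv_fn_ae_eq (v : H0 1) :
    weakDeriv v.fn =ᵐ[volume.restrict (Ioo (0 : ℝ) 1)] derivOp 0 1 v.1 :=
  (hasWeakDeriv_derivOp_zero v 1).weakDeriv_ae_eq

/-! ### Primitives of test functions and the lemma of du Bois-Reymond -/

theorem IsTest.exists_tsupport_subset_Icc {φ : ℝ → ℝ} (h : IsTest φ) :
    ∃ a b : ℝ, 0 < a ∧ a ≤ b ∧ b < 1 ∧ ∀ x, x ∉ Icc a b → φ x = 0 := by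
  rcases (tsupport φ).eq_empty_or_nonempty with he | hne
  · refine ⟨1 / 2, 1 / 2, by norm_num, le_rfl, by norm_num, fun x _ => ?_⟩
    exact image_eq_zero_of_notMem_tsupport (by simp [he])
  · have hc : IsCompact (tsupport φ) := h.compact
    have ha := h.supp (hc.sInf_mem hne)
    have hb := h.supp (hc.sSup_mem hne)
    refine ⟨_, _, ha.1, ?_, hb.2, fun x hx => ?_⟩
    · obtain ⟨y, hy⟩ := hne
      exact (csInf_le hc.bddBelow hy).trans (le_csSup hc.bddAbove hy)
    · refine image_eq_zero_of_notMem_tsupport fun hx' => hx ?_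
      exact ⟨csInf_le hc.bddBelow hx', le_csSup hc.bddAbove hx'⟩

/-- To the left of the support the primitive is zero by construction. To the right it is zero
because the total integral vanishes. -/
theorem IsTest.exists_primitive {ψ : ℝ → ℝ} (h : IsTest ψ) (h0 : ∫ x in (0 : ℝ)..1, ψ x = 0) :
    ∃ φ, IsTest φ ∧ _root_.deriv φ = ψ := by
  obtain ⟨a, b, ha, hab, hb, hz⟩ := h.exists_tsupport_subset_Icc
  set φ : ℝ → ℝ := fun x => ∫ t in (0 : ℝ)..x, ψ t
  have hd : ∀ x, HasDerivAt φ (ψ x) x := fun x =>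
    intervalIntegral.integral_hasDerivAt_right (h.continuous.intervalIntegrable _ _)
      h.continuous.aestronglyMeasurable.stronglyMeasurableAtFilter h.continuous.continuousAt
  have hdf : _root_.deriv φ = ψ := funext fun x => (hd x).deriv
  have hsupp : Function.support φ ⊆ Icc a b := by
    intro x hx
    by_contra hx'
    refine hx ?_
    rcases lt_or_ge x a with h1 | h1
    · refine intervalIntegral.integral_zero_ae (Eventually.of_forall fun t ht => hz t fun ht' => ?_)
      have := ht.2
      have h2 : max 0 x < a := max_lt ha h1
      linarith [ht'.1]
    · have h2 : b < x := not_le.1 fun h3 => hx' ⟨h1, h3⟩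
      have h3 : ∫ t in (1 : ℝ)..x, ψ t = 0 := by
        refine intervalIntegral.integral_zero_ae
          (Eventually.of_forall fun t ht => hz t fun ht' => ?_)
        have := ht.1
        have h4 : b < min 1 x := lt_min hb h2
        linarith [ht'.2]
      have := intervalIntegral.integral_add_adjacent_intervals
        (h.continuous.intervalIntegrable (μ := volume) 0 1) (h.continuous.intervalIntegrable 1 x)
      rw [h0, h3, add_zero] at this
      exact this.symm
  have hts : tsupport φ ⊆ Icc a b := closure_minimal hsupp isClosed_Icc
  refine ⟨φ, ⟨?_, HasCompactSupport.of_support_subset_isCompact isCompact_Icc hsupp, ?_⟩, hdf⟩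
  · rw [contDiff_infty_iff_deriv, hdf]
    exact ⟨fun x => (hd x).differentiableAt, h.smooth⟩
  · exact hts.trans fun x hx => ⟨ha.trans_le hx.1, hx.2.trans_lt hb⟩

theorem exists_isTest_integral_eq_one : ∃ ρ, IsTest ρ ∧ ∫ x in (0 : ℝ)..1, ρ x = 1 := by
  let f : ContDiffBump (1 / 2 : ℝ) := ⟨1 / 8, 1 / 4, by norm_num, by norm_num⟩
  have hts : tsupport f ⊆ Ioo (0 : ℝ) 1 := by
    rw [f.tsupport_eq, Real.closedBall_eq_Icc]
    intro x hx
    simp only [f, mem_Icc] at hx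
    constructor <;> linarith [hx.1, hx.2]
  have hf : IsTest f := ⟨f.contDiff, f.hasCompactSupport, hts⟩
  have hpos : 0 < ∫ x in (0 : ℝ)..1, f x := by
    rw [intervalIntegral.integral_of_le zero_le_one, integral_Ioc_eq_integral_Ioo,
      setIntegral_eq_integral_of_forall_compl_eq_zero fun x hx => hf.eq_zero hx]
    exact f.integral_pos
  refine ⟨_, hf.smul (∫ x in (0 : ℝ)..1, f x)⁻¹, ?_⟩
  simp only [Pi.smul_apply, smul_eq_mul]
  rw [intervalIntegral.integral_const_mul, inv_mul_cancel₀ hpos.ne']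

/-- The lemma of du Bois-Reymond. -/
theorem ae_eq_const_of_forall_integral_mul_deriv {f : ℝ → ℝ} (hf : IntegrableOn f (Ioo 0 1))
    (h : ∀ φ, IsTest φ → ∫ x in Ioo (0 : ℝ) 1, f x * deriv φ x = 0) :
    ∃ c : ℝ, f =ᵐ[volume.restrict (Ioo (0 : ℝ) 1)] fun _ => c := by
  obtain ⟨ρ, hρ, hρ1⟩ := exists_isTest_integral_eq_one
  have hfl := hf.locallyIntegrableOn
  set c := ∫ x in Ioo (0 : ℝ) 1, f x * ρ x
  refine ⟨c, ?_⟩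
  have hconst : LocallyIntegrableOn (fun _ : ℝ => c) (Ioo (0 : ℝ) 1) :=
    (locallyIntegrable_const c).locallyIntegrableOn _
  have := ae_eq_zero_of_forall_integral_mul_test (hfl.sub hconst) fun ψ hψ => by
    set m := ∫ x in (0 : ℝ)..1, ψ x with hm
    -- Subtracting mρ removes the mean of ψ, so the difference is the derivative of a test function
    -- and the hypothesis applies to it. This forces the constant to be the pairing of f with ρ.
    have hχ : IsTest (ψ + (-m) • ρ) := hψ.add (hρ.smul (-m))
    have hχ0 : ∫ x in (0 : ℝ)..1, (ψ + (-m) • ρ) x = 0 := by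
      simp only [Pi.add_apply, Pi.smul_apply, smul_eq_mul]
      rw [intervalIntegral.integral_add (hψ.continuous.intervalIntegrable _ _)
        ((hρ.continuous.intervalIntegrable _ _).const_mul (-m)),
        intervalIntegral.integral_const_mul, hρ1, ← hm]
      ring
    obtain ⟨φ, hφ, hφd⟩ := hχ.exists_primitive hχ0
    have h1 := h φ hφ
    rw [hφd] at h1
    have e : ∀ x, f x * (ψ + (-m) • ρ) x = f x * ψ x - m * (f x * ρ x) := by
      intro x; simp only [Pi.add_apply, Pi.smul_apply, smul_eq_mul]; ring
    simp only [e] at h1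
    rw [integral_sub (LocallyIntegrableOn.integrableOn_mul_test hfl hψ)
      ((LocallyIntegrableOn.integrableOn_mul_test hfl hρ).const_mul m), integral_const_mul] at h1
    simp only [Pi.sub_apply, sub_mul]
    rw [integral_sub (LocallyIntegrableOn.integrableOn_mul_test hfl hψ)
      (LocallyIntegrableOn.integrableOn_mul_test hconst hψ), integral_const_mul,
      ← integral_Ioc_eq_integral_Ioo (f := ψ), ← intervalIntegral.integral_of_le zero_le_one, ← hm]
    linarith
  filter_upwards [this] with x hx
  simpa [sub_eq_zero] using hx

/-! ### The operators D I^β_θ and D, and the range of D -/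

theorem memH1_of_primitive {w : ℝ → ℝ} (g : L2Unit) {c : ℝ}
    (hw : ∀ x ∈ Ioo (0 : ℝ) 1, w x = c + ∫ t in (0 : ℝ)..x, g t) : MemH1 w := by
  refine ⟨?_, g, hasWeakDeriv_of_primitive g.integrableOn hw, Lp.memLp g⟩
  have hi : IntervalIntegrable g volume 0 1 := g.intervalIntegrable (by simp) (by simp)
  have hcont : ContinuousOn (fun x => c + ∫ t in (0 : ℝ)..x, g t) (Icc 0 1) := by
    have := (hi.absolutelyContinuousOnInterval_intervalIntegral (c := 0) (by simp)).continuousOn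
    rw [uIcc_of_le zero_le_one] at this
    exact continuousOn_const.add this
  obtain ⟨C, hC⟩ := isCompact_Icc.exists_bound_of_continuousOn hcont
  refine MemLp.of_bound ?_ C ?_
  · have h1 : AEStronglyMeasurable (fun x => c + ∫ t in (0 : ℝ)..x, g t)
        (volume.restrict (Ioo (0 : ℝ) 1)) :=
      (hcont.mono Ioo_subset_Icc_self).aestronglyMeasurable measurableSet_Ioo
    refine h1.congr ?_
    filter_upwards [ae_restrict_mem measurableSet_Ioo] with x hx
    rw [hw x hx]
  · filter_upwards [ae_restrict_mem measurableSet_Ioo] with x hx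
    rw [hw x hx]
    exact hC x (Ioo_subset_Icc_self hx)

/-- The operator `D I^β_θ` from `H^{1-β}_0(0,1)` to `L²(0,1)`. -/
noncomputable def twoSidedOp (β θ : ℝ) : H0 (1 - β) →L[ℝ] L2Unit :=
  (θ • derivOp β 1 + (1 - θ) • derivOp β (-1)).comp (testSpace (1 - β)).topologicalClosure.subtypeL

/-- The weak derivative on `H^1_0(0,1)`. -/
noncomputable def gradOp : H0 1 →L[ℝ] L2Unit :=
  (derivOp 0 1).comp (testSpace 1).topologicalClosure.subtypeL

theorem twoSidedOp_apply (β θ : ℝ) (u : H0 (1 - β)) :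
    twoSidedOp β θ u = θ • derivOp β 1 u.1 + (1 - θ) • derivOp β (-1) u.1 := rfl

theorem gradOp_apply (v : H0 1) : gradOp v = derivOp 0 1 v.1 := rfl

/-- The left integral vanishes at x = 0, so the constant of integration comes from the right
integral alone. -/
theorem twoSidedInt_eq {β : ℝ} (hβ0 : 0 < β) (hβ1 : β < 1 / 2) (θ : ℝ) (u : H0 (1 - β))
    {x : ℝ} (hx : x ∈ Icc (0 : ℝ) 1) :
    twoSidedInt β θ u.fn x
      = (1 - θ) * rightInt β u.fn 0 + ∫ t in (0 : ℝ)..x, twoSidedOp β θ u t := by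
  have h0 : (0 : ℝ) ∈ Icc (0 : ℝ) 1 := by simp
  have h1 : (1 : ℝ) ∈ Icc (0 : ℝ) 1 := by simp
  have e : (twoSidedOp β θ u : ℝ → ℝ) =ᵐ[volume.restrict (Ioo (0 : ℝ) 1)]
      fun t => θ * derivOp β 1 u.1 t + (1 - θ) * derivOp β (-1) u.1 t := by
    rw [twoSidedOp_apply]
    filter_upwards [Lp.coeFn_add (θ • derivOp β 1 u.1) ((1 - θ) • derivOp β (-1) u.1),
      Lp.coeFn_smul θ (derivOp β 1 u.1), Lp.coeFn_smul (1 - θ) (derivOp β (-1) u.1)] with t a b c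
    rw [a, Pi.add_apply, b, c]
    rfl
  have hadd := intervalIntegral.integral_add_adjacent_intervals
    ((derivOp β (-1) u.1).intervalIntegrable h0 hx) ((derivOp β (-1) u.1).intervalIntegrable hx h1)
  rw [intervalIntegral_congr_of_ae_restrict le_rfl hx.1 hx.2 e, intervalIntegral.integral_add
    (((derivOp β 1 u.1).intervalIntegrable h0 hx).const_mul θ)
    (((derivOp β (-1) u.1).intervalIntegrable h0 hx).const_mul (1 - θ)),
    intervalIntegral.integral_const_mul, intervalIntegral.integral_const_mul, twoSidedInt,
    leftInt_eq_integral_derivOp hβ0 hβ1 u hx, rightInt_eq_integral_derivOp hβ0 hβ1 u hx,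
    rightInt_eq_integral_derivOp hβ0 hβ1 u h0, ← hadd]
  ring

theorem memH1_twoSidedInt {β : ℝ} (hβ0 : 0 < β) (hβ1 : β < 1 / 2) (θ : ℝ) (u : H0 (1 - β)) :
    MemH1 (twoSidedInt β θ u.fn) :=
  memH1_of_primitive _ fun _ hx => twoSidedInt_eq hβ0 hβ1 θ u (Ioo_subset_Icc_self hx)

theorem weakDeriv_twoSidedInt_ae_eq {β : ℝ} (hβ0 : 0 < β) (hβ1 : β < 1 / 2) (θ : ℝ)
    (u : H0 (1 - β)) : weakDeriv (twoSidedInt β θ u.fn)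
      =ᵐ[volume.restrict (Ioo (0 : ℝ) 1)] twoSidedOp β θ u :=
  (hasWeakDeriv_of_primitive (L2Unit.integrableOn _) fun _ hx =>
    twoSidedInt_eq hβ0 hβ1 θ u (Ioo_subset_Icc_self hx)).weakDeriv_ae_eq

theorem norm_sq_gradOp (v : H0 1) : ‖gradOp v‖ ^ 2 = ‖v.1.snd‖ ^ 2 := by
  have c2 := continuous_snd_H0 (s := 1)
  refine H0.induction (P := fun v : H0 1 => ‖gradOp v‖ ^ 2 = ‖v.1.snd‖ ^ 2)
    (isClosed_eq (by fun_prop) (by fun_prop)) (fun v φ h => ?_) v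
  rw [← real_inner_self_eq_norm_sq, gradOp_apply,
    inner_eq_integral_of_ae (coeFn_derivOp_zero 1 h) (coeFn_derivOp_zero 1 h),
    setIntegral_eq_integral_of_forall_compl_eq_zero (fun x hx => by
      rw [h.test.deriv.eq_zero hx, mul_zero]),
    ← re_inner_eq_integral_of_ae (coeFn_fourierOp_zero 1 h) (coeFn_fourierOp_zero 1 h),
    re_inner_fourierOp, norm_sq_snd_of_repBy h]
  refine integral_congr_ae ?_
  filter_upwards [h.snd] with ξ hξ
  have := re_conj_phase_zero_mul_phase 1 1 0 ξ
  rw [mul_zero, zero_div, Real.cos_zero] at this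
  rw [hξ, ← Complex.normSq_eq_conj_mul_self (z := weightedFourier 1 φ ξ), Complex.re_mul_ofReal, Complex.normSq_eq_norm_sq,
    this, one_mul]

theorem norm_sq_le_gradOp (v : H0 1) : ‖v‖ ^ 2 ≤ 3 * ‖gradOp v‖ ^ 2 := by
  rw [norm_sq_gradOp]; exact norm_sq_le_snd zero_le_one v

/-- The constant function `1` in `L²(0,1)`. -/
noncomputable def oneL2 : L2Unit := Lp.const 2 (volume.restrict (Ioo (0 : ℝ) 1)) (1 : ℝ)

theorem coeFn_oneL2 : oneL2 =ᵐ[volume.restrict (Ioo (0 : ℝ) 1)] fun _ => (1 : ℝ) :=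
  Lp.coeFn_const 2 _ 1

theorem inner_oneL2_gradOp (v : H0 1) : inner ℝ oneL2 (gradOp v) = 0 := by
  refine H0.induction (P := fun v => inner ℝ oneL2 (gradOp v) = 0)
    (isClosed_eq (by fun_prop) continuous_const) (fun v φ h => ?_) v
  rw [gradOp_apply, inner_eq_integral_of_ae coeFn_oneL2 (coeFn_derivOp_zero 1 h)]
  simp only [one_mul]
  rw [← integral_Ioc_eq_integral_Ioo, ← intervalIntegral.integral_of_le zero_le_one,
    intervalIntegral.integral_deriv_eq_sub (fun x _ => (h.test.hasDerivAt x).differentiableAt)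
    (h.test.deriv.continuous.intervalIntegrable _ _), h.test.eq_zero (x := 1) (by simp),
    h.test.eq_zero (x := 0) (by simp), sub_zero]

theorem exists_smul_oneL2_of_forall_inner_gradOp {y : L2Unit} (h : ∀ v, inner ℝ y (gradOp v) = 0) :
    ∃ c : ℝ, y = c • oneL2 := by
  obtain ⟨c, hc⟩ := ae_eq_const_of_forall_integral_mul_deriv y.integrableOn fun φ hφ => by
    obtain ⟨v, hv⟩ := exists_repBy zero_le_one hφ
    rw [← inner_eq_integral_of_ae (EventuallyEq.refl _ _) (coeFn_derivOp_zero 1 hv)]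
    exact h v
  refine ⟨c, ?_⟩
  ext1
  filter_upwards [hc, coeFn_oneL2, Lp.coeFn_smul c oneL2] with x h1 h2 h3
  rw [h1, h3, Pi.smul_apply, h2, smul_eq_mul, mul_one]

/-- Poincaré bounds the gradient from below (2 ≥ √3 serves as constant), so its range is closed. By
du Bois-Reymond the orthogonal complement of the range consists of constants. -/
theorem exists_gradOp_eq {y : L2Unit} (h : inner ℝ oneL2 y = 0) : ∃ v, gradOp v = y := by
  have hanti : AntilipschitzWith 2 gradOp := by
    refine AddMonoidHomClass.antilipschitz_of_bound _ fun v => ?_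
    have := norm_sq_le_gradOp v
    refine abs_le_of_sq_le_sq' ?_ (by positivity) |>.2
    rw [mul_pow]
    refine this.trans ?_
    have := sq_nonneg ‖gradOp v‖
    norm_num
    nlinarith
  have hcl : IsClosed (Set.range gradOp) := hanti.isClosed_range gradOp.uniformContinuous
  set R : Submodule ℝ L2Unit := LinearMap.range gradOp.toLinearMap with hR
  have hRc : IsClosed (R : Set L2Unit) := by
    exact hcl
  have : CompleteSpace R := hRc.completeSpace_coe
  have hmem : y ∈ Rᗮᗮ := by
    rw [Submodule.mem_orthogonal]
    intro z hz
    obtain ⟨c, rfl⟩ := exists_smul_oneL2_of_forall_inner_gradOp (y := z) fun v => by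
      rw [real_inner_comm]
      exact (Submodule.mem_orthogonal R z).1 hz _ ⟨v, rfl⟩
    rw [inner_smul_left, h, mul_zero]
  rw [Submodule.orthogonal_orthogonal] at hmem
  exact hmem

/-- The choice u = v would turn the pairing into the energy of v. To avoid an embedding of H^1_0
into H^{1-β}_0 it is made on approximants: the same test function is read as w_n in H^1_0 and as p_n
in H^{1-β}_0, with pairing at least a multiple of its L² norm squared. Orthogonality to v makes that
pairing tend to zero. -/
theorem eq_zero_of_forall_inner_twoSidedOp {β θ : ℝ} (hβ0 : 0 < β) (hβ1 : β < 1 / 2) (v : H0 1)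
    (h : ∀ u, inner ℝ (twoSidedOp β θ u) (gradOp v) = 0) : v = 0 := by
  have hcos : 0 < Real.cos (Real.pi * β / 2) := by
    refine Real.cos_pos_of_mem_Ioo ⟨?_, ?_⟩ <;> nlinarith [Real.pi_pos]
  obtain ⟨w, φ, hw, hlim⟩ := v.exists_seq
  choose p hp using fun n => exists_repBy (s := 1 - β) (by linarith) (hw n).test
  -- From |ω|^{2(1-β)} ≤ 1 + |ω|² one gets ‖p_n‖² ≤ 2‖w_n‖².
  have hpn : ∀ n, ‖p n‖ ≤ 2 * ‖w n‖ := by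
    intro n
    have e1 : ‖p n‖ ^ 2 = ‖(p n).1.fst‖ ^ 2 + ‖(p n).1.snd‖ ^ 2 :=
      WithLp.prod_norm_sq_eq_of_L2 (p n).1
    have e2 : ‖w n‖ ^ 2 = ‖(w n).1.fst‖ ^ 2 + ‖(w n).1.snd‖ ^ 2 :=
      WithLp.prod_norm_sq_eq_of_L2 (w n).1
    have e3 : ‖(p n).1.fst‖ ^ 2 = ‖(w n).1.fst‖ ^ 2 := by
      rw [norm_sq_fst_of_repBy (hp n), norm_sq_fst_of_repBy (hw n)]
    have hF : ∫ ξ, ‖weightedFourier 0 (φ n) ξ‖ ^ 2 = ‖(w n).1.fst‖ ^ 2 := by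
      rw [norm_sq_fst_of_repBy (hw n)]
      have := SchwartzMap.integral_norm_sq_fourier (hw n).test.schwartz
      rw [(hw n).test.fourier_schwartz] at this
      simp only [weightedFourier, Real.rpow_zero, Complex.ofReal_one, one_mul]
      rw [this]
      congr 1; ext x; simp
    have i : ∀ s, 0 ≤ s → Integrable fun ξ => ‖weightedFourier s (φ n) ξ‖ ^ 2 := fun s hs =>
      (memLp_weightedFourier hs (hw n).test 2).integrable_norm_pow (by norm_num)
    have e4 : ‖(p n).1.snd‖ ^ 2 ≤ ‖(w n).1.fst‖ ^ 2 + ‖(w n).1.snd‖ ^ 2 := by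
      rw [norm_sq_snd_of_repBy (hp n), norm_sq_snd_of_repBy (hw n), ← hF,
        ← integral_add (i 0 le_rfl) (i 1 zero_le_one)]
      refine integral_mono (i _ (by linarith)) ((i 0 le_rfl).add (i 1 zero_le_one)) fun ξ => ?_
      simp only [weightedFourier, norm_mul, mul_pow, Complex.norm_real, Real.norm_eq_abs, sq_abs]
      rw [← add_mul]
      refine mul_le_mul_of_nonneg_right ?_ (sq_nonneg _)
      have ha : 0 ≤ |2 * Real.pi * ξ| := abs_nonneg _
      rw [Real.rpow_zero, Real.rpow_one]
      rcases le_total |2 * Real.pi * ξ| 1 with h1 | h1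
      · have : |2 * Real.pi * ξ| ^ (1 - β) ≤ 1 := Real.rpow_le_one ha h1 (by linarith)
        have h2 : 0 ≤ |2 * Real.pi * ξ| ^ (1 - β) := by positivity
        nlinarith
      · have : |2 * Real.pi * ξ| ^ (1 - β) ≤ |2 * Real.pi * ξ| ^ (1 : ℝ) :=
          Real.rpow_le_rpow_of_exponent_le h1 (by linarith)
        rw [Real.rpow_one] at this
        have h2 : 0 ≤ |2 * Real.pi * ξ| ^ (1 - β) := by positivity
        nlinarith
    refine abs_le_of_sq_le_sq' ?_ (by positivity) |>.2
    nlinarith [sq_nonneg ‖w n‖]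
  have key : ∀ n, Real.cos (Real.pi * β / 2) / 2 * ‖(w n).1.fst‖ ^ 2
      ≤ ‖twoSidedOp β θ‖ * (2 * ‖w n‖) * ‖gradOp (w n - v)‖ := by
    intro n
    have e1 : inner ℝ (twoSidedOp β θ (p n)) (gradOp (w n))
        = Real.cos (Real.pi * β / 2) * ∫ ξ, ‖weightedFourier (1 - β / 2) (φ n) ξ‖ ^ 2 := by
      have hσ : |(-1 : ℝ)| = 1 := by simp
      rw [twoSidedOp_apply, inner_add_left, inner_smul_left, inner_smul_left, gradOp_apply,
        inner_derivOp_deriv abs_one hβ0 (by linarith) (hp n) (hw n),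
        inner_derivOp_deriv hσ hβ0 (by linarith) (hp n) (hw n)]
      simp only [conj_trivial]
      ring
    have e2 := (hw n).test.integral_sq_le (r := 1 - β / 2) (by linarith)
    rw [← norm_sq_fst_of_repBy (hw n)] at e2
    have e3 : inner ℝ (twoSidedOp β θ (p n)) (gradOp (w n))
        = inner ℝ (twoSidedOp β θ (p n)) (gradOp (w n - v)) := by
      rw [map_sub, inner_sub_right, h, sub_zero]
    have e4 : inner ℝ (twoSidedOp β θ (p n)) (gradOp (w n - v))
        ≤ ‖twoSidedOp β θ‖ * (2 * ‖w n‖) * ‖gradOp (w n - v)‖ := by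
      refine (real_inner_le_norm _ _).trans ?_
      gcongr
      refine ((twoSidedOp β θ).le_opNorm _).trans ?_
      gcongr
      exact hpn n
    nlinarith
  have hfc : Continuous fun u : H0 1 => u.1.fst :=
    (WithLp.fstL 2 ℝ _ _).continuous.comp continuous_subtype_val
  have l1 : Tendsto (fun n => Real.cos (Real.pi * β / 2) / 2 * ‖(w n).1.fst‖ ^ 2) atTop
      (𝓝 (Real.cos (Real.pi * β / 2) / 2 * ‖v.1.fst‖ ^ 2)) :=
    ((((hfc.tendsto v).comp hlim).norm).pow 2).const_mul _
  have l2 : Tendsto (fun n => ‖twoSidedOp β θ‖ * (2 * ‖w n‖) * ‖gradOp (w n - v)‖) atTop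
      (𝓝 (‖twoSidedOp β θ‖ * (2 * ‖v‖) * ‖gradOp (v - v)‖)) := by
    have : Continuous fun z : H0 1 => ‖twoSidedOp β θ‖ * (2 * ‖z‖) * ‖gradOp (z - v)‖ := by
      fun_prop
    exact (this.tendsto v).comp hlim
  have hle := le_of_tendsto_of_tendsto' l1 l2 key
  rw [sub_self, map_zero, norm_zero, mul_zero] at hle
  have hfst : v.1.fst = 0 := by
    have : ‖v.1.fst‖ ^ 2 ≤ 0 := by
      by_contra hcon
      have := mul_pos (half_pos hcos) (not_le.1 hcon)
      linarith
    have h2 : ‖v.1.fst‖ ^ 2 = 0 := le_antisymm this (sq_nonneg _)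
    exact norm_eq_zero.1 (pow_eq_zero_iff (two_ne_zero) |>.1 h2)
  have hg : gradOp v = 0 := by
    ext1
    refine EventuallyEq.trans ?_ (Lp.coeFn_zero ℝ 2 _).symm
    refine ae_eq_zero_of_forall_integral_mul_test
      (L2Unit.integrableOn _).locallyIntegrableOn fun φ hφ => ?_
    have e1 := (hasWeakDeriv_derivOp_zero v 1).2.2 φ hφ
    have e2 : ∫ x in Ioo (0 : ℝ) 1, v.fn x * deriv φ x = 0 := by
      refine integral_eq_zero_of_ae (ae_restrict_of_ae ?_)
      have : v.fn =ᵐ[volume] 0 := by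
        rw [H0.fn, hfst]; exact Lp.coeFn_zero ℝ 2 _
      filter_upwards [this] with x hx
      rw [hx]; simp
    rw [e2] at e1
    rw [gradOp_apply]
    linarith
  have := norm_sq_le_gradOp v
  rw [hg, norm_zero] at this
  have h2 : ‖v‖ ^ 2 = 0 := le_antisymm (by simpa using this) (sq_nonneg _)
  exact norm_eq_zero.1 (pow_eq_zero_iff (two_ne_zero) |>.1 h2)

/-! ### A function orthogonal to the range for θ = 1 -/

theorem intervalIntegrable_beta {β : ℝ} (hβ0 : 0 < β) (hβ1 : β < 1) :
    IntervalIntegrable (fun t : ℝ => t ^ (β - 1) * (1 - t) ^ (-β)) volume 0 1 := by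
  have h := (Complex.betaIntegral_convergent (u := (β : ℂ)) (v := ((1 - β : ℝ) : ℂ))
    (by simpa using hβ0) (by simpa using hβ1)).norm
  rw [intervalIntegrable_iff_integrableOn_Ioo_of_le zero_le_one] at h ⊢
  refine h.congr_fun (fun t ht => ?_) measurableSet_Ioo
  have h1 : (0 : ℝ) < 1 - t := sub_pos.2 ht.2
  simp only
  rw [norm_mul, show ((β : ℂ) - 1) = ((β - 1 : ℝ) : ℂ) by push_cast; rfl,
    show (((1 - β : ℝ) : ℂ) - 1) = ((-β : ℝ) : ℂ) by push_cast; ring,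
    show (1 - (t : ℂ)) = ((1 - t : ℝ) : ℂ) by push_cast; rfl, Complex.norm_cpow_real,
    Complex.norm_cpow_real, Complex.norm_real, Complex.norm_real, Real.norm_of_nonneg ht.1.le,
    Real.norm_of_nonneg h1.le]

/-- The kernel identity behind `I^β ∘ I^{1-β}`: the value does not depend on `s`. -/
theorem integral_beta_kernel {β : ℝ} (hβ0 : 0 < β) (hβ1 : β < 1) {s : ℝ}
    (hs : s ∈ Ioo (0 : ℝ) 1) :
    IntegrableOn (fun x => (x - s) ^ (β - 1) * (1 - x) ^ (-β)) (Ioo s 1) ∧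
      ∫ x in Ioo s 1, (x - s) ^ (β - 1) * (1 - x) ^ (-β)
        = ∫ t in (0 : ℝ)..1, t ^ (β - 1) * (1 - t) ^ (-β) := by
  set b : ℝ → ℝ := fun t => t ^ (β - 1) * (1 - t) ^ (-β)
  have hr : 0 < 1 - s := sub_pos.2 hs.2
  set c : ℝ := (1 - s)⁻¹ with hc
  have hc0 : 0 < c := inv_pos.2 hr
  have hcr : c * (1 - s) = 1 := inv_mul_cancel₀ hr.ne'
  have hpt : ∀ x ∈ Ioo s 1, c * b (c * x - c * s) = (x - s) ^ (β - 1) * (1 - x) ^ (-β) := by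
    intro x hx
    have e1 : c * x - c * s = c * (x - s) := by ring
    have e2 : 1 - c * (x - s) = c * (1 - x) := by linear_combination (-1 : ℝ) * hcr
    simp only [b]
    rw [e1, e2, Real.mul_rpow hc0.le (sub_nonneg.2 hx.1.le),
      Real.mul_rpow hc0.le (sub_nonneg.2 hx.2.le)]
    -- The two exponents add up to -1 and cancel the Jacobian of the rescaling of (s,1) to (0,1).
    have e3 : c * (c ^ (β - 1) * c ^ (-β)) = 1 := by
      rw [← Real.rpow_add hc0, show β - 1 + -β = -1 by ring, Real.rpow_neg_one,
        mul_inv_cancel₀ hc0.ne']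
    linear_combination (x - s) ^ (β - 1) * (1 - x) ^ (-β) * e3
  have e0 : c * s - c * s = 0 := sub_self _
  have e1 : c * 1 - c * s = 1 := by rw [← mul_sub, hcr]
  have hi : IntervalIntegrable (fun x => c * b (c * x - c * s)) volume s 1 := by
    have h1 := (((intervalIntegrable_beta hβ0 hβ1).comp_sub_right (c * s)).comp_mul_left (c := c))
    have e2 : (0 + c * s) / c = s := by field_simp; ring
    have e3 : (1 + c * s) / c = 1 := by
      rw [div_eq_iff hc0.ne']; linarith
    rw [e2, e3] at h1
    exact h1.const_mul c
  constructor
  · rw [intervalIntegrable_iff_integrableOn_Ioo_of_le hs.2.le] at hi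
    exact hi.congr_fun hpt measurableSet_Ioo
  · rw [← setIntegral_congr_fun measurableSet_Ioo hpt, ← integral_Ioc_eq_integral_Ioo,
      ← intervalIntegral.integral_of_le hs.2.le, intervalIntegral.integral_const_mul,
      intervalIntegral.integral_comp_mul_sub b hc0.ne', e0, e1, smul_eq_mul, ← mul_assoc,
      mul_inv_cancel₀ hc0.ne', one_mul]

/-- By Fubini the x-integral of the kernel is done first. It is the same Beta constant for every s,
so what remains is a multiple of ∫ φ' = 0. -/
theorem integral_fracInt_deriv_mul_rpow {β : ℝ} (hβ0 : 0 < β) (hβ1 : β < 1) {φ : ℝ → ℝ}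
    (h : IsTest φ) :
    ∫ x in Ioo (0 : ℝ) 1, fracInt β 1 (deriv φ) x * (1 - x) ^ (-β) = 0 := by
  set ψ := deriv φ with hψdef
  have hψ : IsTest ψ := h.deriv
  set μ := volume.restrict (Ioo (0 : ℝ) 1)
  set F : ℝ → ℝ → ℝ := fun x s => (Ioi s).indicator
    (fun x => ψ s * ((x - s) ^ (β - 1) * (1 - x) ^ (-β))) x with hF
  set B := ∫ t in (0 : ℝ)..1, t ^ (β - 1) * (1 - t) ^ (-β)
  have hsec : ∀ s ∈ Ioo (0 : ℝ) 1, ∀ a : ℝ,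
      Integrable (fun x => (Ioi s).indicator
        (fun x => a * ((x - s) ^ (β - 1) * (1 - x) ^ (-β))) x) μ ∧
      ∫ x, (Ioi s).indicator (fun x => a * ((x - s) ^ (β - 1) * (1 - x) ^ (-β))) x ∂μ
        = a * B := by
    intro s hs a
    have hset : Ioi s ∩ Ioo (0 : ℝ) 1 = Ioo s 1 := by
      ext x
      constructor
      · rintro ⟨h1, h2⟩; exact ⟨h1, h2.2⟩
      · rintro ⟨h1, h2⟩; exact ⟨h1, hs.1.trans h1, h2⟩
    obtain ⟨k1, k2⟩ := integral_beta_kernel hβ0 hβ1 hs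
    constructor
    · rw [integrable_indicator_iff measurableSet_Ioi, IntegrableOn,
        Measure.restrict_restrict measurableSet_Ioi, hset]
      exact k1.const_mul a
    · rw [integral_indicator measurableSet_Ioi, Measure.restrict_restrict measurableSet_Ioi, hset,
        integral_const_mul, k2]
  have hFmeas : Measurable (Function.uncurry F) := by
    have : Function.uncurry F = {p : ℝ × ℝ | p.2 < p.1}.indicator
        (fun p => ψ p.2 * ((p.1 - p.2) ^ (β - 1) * (1 - p.1) ^ (-β))) := by
      ext ⟨x, s⟩
      by_cases hxs : s < x
      · simp [Function.uncurry, hF, indicator, hxs]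
      · simp [Function.uncurry, hF, indicator, hxs]
    rw [this]
    refine Measurable.indicator ?_ (measurableSet_lt measurable_snd measurable_fst)
    have := hψ.continuous.measurable
    fun_prop
  have hFint : Integrable (Function.uncurry F) (μ.prod μ) := by
    rw [integrable_prod_iff' hFmeas.aestronglyMeasurable]
    constructor
    · filter_upwards [ae_restrict_mem measurableSet_Ioo] with s hs
      exact (hsec s hs (ψ s)).1
    · have h1 : Integrable (fun s => |ψ s| * B) μ :=
        ((hψ.memLp 1 μ).integrable le_rfl).abs.mul_const B
      refine h1.congr ?_
      filter_upwards [ae_restrict_mem measurableSet_Ioo] with s hs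
      rw [← (hsec s hs |ψ s|).2]
      refine integral_congr_ae ?_
      filter_upwards [ae_restrict_mem measurableSet_Ioo] with x hx
      simp only [Function.uncurry, hF]
      by_cases hxs : s < x
      · rw [indicator_of_mem (show x ∈ Ioi s from hxs), indicator_of_mem (show x ∈ Ioi s from hxs),
          norm_mul, Real.norm_eq_abs, Real.norm_of_nonneg]
        exact mul_nonneg (Real.rpow_nonneg (sub_pos.2 hxs).le _)
          (Real.rpow_nonneg (sub_pos.2 hx.2).le _)
      · rw [indicator_of_notMem (show x ∉ Ioi s from hxs),
          indicator_of_notMem (show x ∉ Ioi s from hxs), norm_zero]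
  have hleft : ∀ x ∈ Ioo (0 : ℝ) 1,
      fracInt β 1 ψ x * (1 - x) ^ (-β) = 1 / Real.Gamma β * ∫ s, F x s ∂μ := by
    intro x hx
    have e : ∫ s, F x s ∂μ = ∫ s in Ioo 0 x, ψ s / (x - s) ^ (1 - β) * (1 - x) ^ (-β) := by
      have e1 : ∫ s in Ioo 0 x, F x s = ∫ s in Ioo (0 : ℝ) 1, F x s := by
        refine (setIntegral_eq_of_subset_of_forall_sdiff_eq_zero measurableSet_Ioo
          (Ioo_subset_Ioo_right hx.2.le) fun s hs => ?_).symm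
        have : ¬ s < x := fun h' => hs.2 ⟨hs.1.1, h'⟩
        exact indicator_of_notMem (show x ∉ Ioi s from this) _
      rw [← e1]
      refine setIntegral_congr_fun measurableSet_Ioo fun s hs => ?_
      simp only [hF]
      rw [indicator_of_mem (show x ∈ Ioi s from hs.2), div_eq_mul_inv,
        ← Real.rpow_neg (sub_pos.2 hs.2).le, neg_sub, mul_assoc]
    rw [e, ← leftInt_eq_fracInt hψ, leftInt, integral_mul_const, mul_assoc]
  rw [setIntegral_congr_fun measurableSet_Ioo hleft, integral_const_mul,
    integral_integral_swap hFint]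
  have e : ∫ s, ∫ x, F x s ∂μ ∂μ = ∫ s, ψ s * B ∂μ := by
    refine integral_congr_ae ?_
    filter_upwards [ae_restrict_mem measurableSet_Ioo] with s hs
    exact (hsec s hs (ψ s)).2
  have e0 : ∫ s, ψ s ∂μ = 0 := by
    rw [← integral_Ioc_eq_integral_Ioo, ← intervalIntegral.integral_of_le zero_le_one,
      intervalIntegral.integral_deriv_eq_sub (fun x _ => (h.hasDerivAt x).differentiableAt)
      (hψ.continuous.intervalIntegrable _ _), h.eq_zero (x := 1) (by simp),
      h.eq_zero (x := 0) (by simp), sub_zero]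
  rw [e, integral_mul_const, e0, zero_mul, mul_zero]

/-- The range of the left fractional derivative has a nontrivial orthogonal complement. -/
theorem exists_ne_zero_inner_derivOp_eq_zero {β : ℝ} (hβ0 : 0 < β) (hβ1 : β < 1 / 2) :
    ∃ g : L2Unit, g ≠ 0 ∧ ∀ u : H0 (1 - β), inner ℝ (derivOp β 1 u.1) g = 0 := by
  have hg : MemLp (fun x : ℝ => (1 - x) ^ (-β)) 2 (volume.restrict (Ioo (0 : ℝ) 1)) := by
    rw [memLp_two_iff_integrable_sq (Measurable.aestronglyMeasurable (by fun_prop))]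
    -- Square integrability of (1-x)^{-β} is exactly the condition β < 1/2.
    have h1 : IntervalIntegrable (fun x : ℝ => (1 - x) ^ (-(2 * β))) volume 0 1 := by
      have := ((intervalIntegral.intervalIntegrable_rpow' (a := 0) (b := 1)
        (r := -(2 * β)) (by linarith)).comp_sub_left 1).symm
      simpa using this
    rw [intervalIntegrable_iff_integrableOn_Ioo_of_le zero_le_one] at h1
    refine h1.congr_fun (fun x hx => ?_) measurableSet_Ioo
    simp only
    rw [← Real.rpow_natCast, ← Real.rpow_mul (sub_pos.2 hx.2).le]
    congr 1; push_cast; ring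
  refine ⟨hg.toLp, fun h0 => ?_, fun u => ?_⟩
  · have hz : ∀ᵐ x ∂(volume.restrict (Ioo (0 : ℝ) 1)), False := by
      have h2 := Lp.coeFn_zero ℝ 2 (volume.restrict (Ioo (0 : ℝ) 1))
      rw [← h0] at h2
      filter_upwards [h2, hg.coeFn_toLp, ae_restrict_mem measurableSet_Ioo] with x a b c
      rw [b] at a
      exact (Real.rpow_pos_of_pos (sub_pos.2 c.2) _).ne' a
    rw [eventually_false_iff_eq_bot, ae_eq_bot, Measure.restrict_eq_zero] at hz
    simp at hz
  · have c3 : Continuous fun u : H0 (1 - β) => derivOp β 1 u.1 :=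
      (derivOp β 1).continuous.comp continuous_subtype_val
    refine H0.induction (P := fun u => inner ℝ (derivOp β 1 u.1) hg.toLp = 0)
      (isClosed_eq (by fun_prop) continuous_const) (fun u φ h => ?_) u
    rw [inner_eq_integral_of_ae (coeFn_derivOp abs_one hβ0 (by linarith) h) hg.coeFn_toLp]
    exact integral_fracInt_deriv_mul_rpow hβ0 (by linarith) h.test

/-! ### Lower bound, method of continuity, codimension one -/

/-- Pairing with the sum Z of the two one-sided derivatives leaves nonnegative squares plus θ +
(1-θ) = 1 times the mixed product, which equals cos(πβ) times the squared seminorm. The constant is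
therefore uniform in θ, as the method of continuity requires. -/
theorem exists_pos_mul_norm_le_twoSidedOp {β : ℝ} (hβ0 : 0 < β) (hβ1 : β < 1 / 2) :
    ∃ c : ℝ, 0 < c ∧ ∀ θ ∈ Icc (0 : ℝ) 1, ∀ u, c * ‖u‖ ≤ ‖twoSidedOp β θ u‖ := by
  have hcos : 0 < Real.cos (Real.pi * β) := by
    refine Real.cos_pos_of_mem_Ioo ⟨?_, ?_⟩ <;> nlinarith [Real.pi_pos]
  set Z := derivOp β 1 + derivOp β (-1)
  set M := ‖Z‖ + 1 with hM
  have hM0 : 0 < M := by positivity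
  -- The 3 is the cost of passing from the seminorm to the full norm; M exceeds ‖Z‖ by one only to
  -- be positive.
  refine ⟨Real.cos (Real.pi * β) / (3 * M), by positivity, fun θ hθ u => ?_⟩
  have e1 := inner_derivOp_one_neg_one hβ0 (by linarith) u
  have e2 : Real.cos (Real.pi * β) * ‖u.1.snd‖ ^ 2 ≤ inner ℝ (twoSidedOp β θ u) (Z u.1) := by
    have : inner ℝ (twoSidedOp β θ u) (Z u.1) = θ * ‖derivOp β 1 u.1‖ ^ 2
        + (1 - θ) * ‖derivOp β (-1) u.1‖ ^ 2
        + inner ℝ (derivOp β 1 u.1) (derivOp β (-1) u.1) := by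
      rw [twoSidedOp_apply, show Z u.1 = derivOp β 1 u.1 + derivOp β (-1) u.1 from rfl,
        inner_add_left, inner_smul_left, inner_smul_left, inner_add_right, inner_add_right,
        real_inner_self_eq_norm_sq, real_inner_self_eq_norm_sq,
        real_inner_comm (derivOp β 1 u.1) (derivOp β (-1) u.1)]
      simp only [conj_trivial]
      ring
    rw [this, e1]
    have h1 := mul_nonneg hθ.1 (sq_nonneg ‖derivOp β 1 u.1‖)
    have h2 := mul_nonneg (sub_nonneg.2 hθ.2) (sq_nonneg ‖derivOp β (-1) u.1‖)
    linarith
  have e3 : inner ℝ (twoSidedOp β θ u) (Z u.1) ≤ ‖twoSidedOp β θ u‖ * (M * ‖u‖) := by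
    refine (real_inner_le_norm _ _).trans ?_
    gcongr
    refine (Z.le_opNorm _).trans ?_
    have : ‖u.1‖ = ‖u‖ := rfl
    rw [this]
    gcongr
    linarith
  have e4 := norm_sq_le_snd (by linarith : 0 ≤ 1 - β) u
  rcases eq_or_lt_of_le (norm_nonneg u) with h0 | h0
  · rw [← h0, mul_zero]; exact norm_nonneg _
  · rw [div_mul_eq_mul_div, div_le_iff₀ (by positivity)]
    have h5 : Real.cos (Real.pi * β) * ‖u‖ * ‖u‖ ≤ ‖twoSidedOp β θ u‖ * (3 * M) * ‖u‖ := by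
      nlinarith
    exact le_of_mul_le_mul_right h5 h0

theorem isClosed_range_of_mul_norm_le {E F : Type*} [NormedAddCommGroup E] [NormedSpace ℝ E]
    [CompleteSpace E] [NormedAddCommGroup F] [NormedSpace ℝ F] {T : E →L[ℝ] F} {c : ℝ} (hc : 0 < c)
    (h : ∀ u, c * ‖u‖ ≤ ‖T u‖) : IsClosed (LinearMap.range T.toLinearMap : Set F) := by
  have hanti : AntilipschitzWith (Real.toNNReal c⁻¹) T := by
    refine AddMonoidHomClass.antilipschitz_of_bound _ fun v => ?_
    rw [Real.coe_toNNReal _ (inv_pos.2 hc).le, inv_mul_eq_div, le_div_iff₀ hc, mul_comm]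
    exact h v
  exact hanti.isClosed_range T.uniformContinuous

/-- One step of the method of continuity. -/
theorem surjective_of_norm_sub_lt {E F : Type*} [NormedAddCommGroup E] [NormedSpace ℝ E]
    [CompleteSpace E] [NormedAddCommGroup F] [InnerProductSpace ℝ F] [CompleteSpace F]
    {T T' : E →L[ℝ] F} {c : ℝ} (hc : 0 < c) (h : ∀ u, c * ‖u‖ ≤ ‖T u‖)
    (h' : ∀ u, c * ‖u‖ ≤ ‖T' u‖) (hT : Function.Surjective T) (hlt : ‖T - T'‖ < c) :
    Function.Surjective T' := by
  have hcl := isClosed_range_of_mul_norm_le hc h'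
  set R := LinearMap.range T'.toLinearMap
  have : CompleteSpace R := hcl.completeSpace_coe
  have hbot : Rᗮ = ⊥ := by
    rw [Submodule.eq_bot_iff]
    intro y hy
    obtain ⟨u, rfl⟩ := hT y
    have h1 : inner ℝ (T' u) (T u) = 0 := (Submodule.mem_orthogonal R _).1 hy _ ⟨u, rfl⟩
    -- A nonzero T u orthogonal to the range of T' would satisfy ‖T u‖² = ((T-T')u, T u) ≤ ‖T-T'‖
    -- ‖u‖ ‖T u‖ < ‖T u‖².
    have h2 : ‖T u‖ ^ 2 = inner ℝ ((T - T') u) (T u) := by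
      rw [sub_apply, inner_sub_left, h1, sub_zero, real_inner_self_eq_norm_sq]
    have h3 := real_inner_le_norm ((T - T') u) (T u)
    have h4 := (T - T').le_opNorm u
    by_contra hne
    have h5 : 0 < ‖T u‖ := norm_pos_iff.2 hne
    have h6 : 0 < ‖u‖ := norm_pos_iff.2 fun h0 => hne (by rw [h0, map_zero])
    have h7 : ‖T - T'‖ * ‖u‖ < ‖T u‖ := (mul_lt_mul_of_pos_right hlt h6).trans_le (h u)
    nlinarith
  have htop : R = ⊤ := by
    rw [← Submodule.orthogonal_orthogonal R, hbot, Submodule.bot_orthogonal_eq_top]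
  exact LinearMap.range_eq_top.1 htop

theorem twoSidedOp_sub (β θ τ : ℝ) : twoSidedOp β θ - twoSidedOp β τ = (θ - τ) •
    (derivOp β 1 - derivOp β (-1)).comp (testSpace (1 - β)).topologicalClosure.subtypeL := by
  ext1 u
  rw [sub_apply, twoSidedOp_apply, twoSidedOp_apply]
  change _ = (θ - τ) • (derivOp β 1 u.1 - derivOp β (-1) u.1)
  module

/-- Surjectivity at θ would travel in N equal steps to θ = 1, where a nonzero function is orthogonal
to the range. -/
theorem not_surjective_twoSidedOp {β θ : ℝ} (hβ0 : 0 < β) (hβ1 : β < 1 / 2)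
    (hθ : θ ∈ Icc (0 : ℝ) 1) : ¬ Function.Surjective (twoSidedOp β θ) := by
  intro hsurj
  obtain ⟨c, hc, hb⟩ := exists_pos_mul_norm_le_twoSidedOp hβ0 hβ1
  set Z := (derivOp β 1 - derivOp β (-1)).comp (testSpace (1 - β)).topologicalClosure.subtypeL
  -- The operator is affine in θ with slope Z, so steps of length at most 1/N < c/‖Z‖ change it by
  -- less than c in norm.
  obtain ⟨N, hN⟩ := exists_nat_gt (‖Z‖ / c)
  have hN0 : (0 : ℝ) < N := lt_of_le_of_lt (by positivity) hN
  have hstep : ∀ k : ℕ, k ≤ N → Function.Surjective (twoSidedOp β (θ + (1 - θ) * (k / N))) := by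
    have hmem : ∀ k : ℕ, k ≤ N → θ + (1 - θ) * (k / N) ∈ Icc (0 : ℝ) 1 := by
      intro k hk
      have h1 : (k : ℝ) / N ≤ 1 := (div_le_one hN0).2 (by exact_mod_cast hk)
      have h2 : (0 : ℝ) ≤ k / N := by positivity
      have h3 := sub_nonneg.2 hθ.2
      constructor
      · have := hθ.1; positivity
      · nlinarith
    intro k
    induction k with
    | zero => intro _; simpa using hsurj
    | succ k ih =>
      intro hk
      refine surjective_of_norm_sub_lt hc (hb _ (hmem k (by omega))) (hb _ (hmem _ hk))
        (ih (by omega)) ?_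
      rw [twoSidedOp_sub]
      refine (ContinuousLinearMap.opNorm_smul_le _ _).trans_lt ?_
      have e : θ + (1 - θ) * (k / N) - (θ + (1 - θ) * ((k + 1 : ℕ) / N)) = -((1 - θ) / N) := by
        push_cast; field_simp; ring
      rw [e, norm_neg, Real.norm_of_nonneg (div_nonneg (sub_nonneg.2 hθ.2) hN0.le)]
      have h1 : ‖Z‖ < c * N := by rw [div_lt_iff₀ hc] at hN; linarith
      have h2 : ‖Z‖ / N < c := (div_lt_iff₀ hN0).2 h1
      have h3 : (1 - θ) * ‖Z‖ ≤ ‖Z‖ :=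
        mul_le_of_le_one_left (ContinuousLinearMap.opNorm_nonneg Z) (by linarith [hθ.1])
      calc (1 - θ) / N * ‖Z‖ = (1 - θ) * ‖Z‖ / N := by ring
        _ ≤ ‖Z‖ / N := by gcongr
        _ < c := h2
  have h1 := hstep N le_rfl
  rw [div_self hN0.ne', mul_one, add_sub_cancel] at h1
  obtain ⟨g, hg0, hg⟩ := exists_ne_zero_inner_derivOp_eq_zero hβ0 hβ1
  obtain ⟨u, hu⟩ := h1 g
  have h2 : twoSidedOp β 1 u = derivOp β 1 u.1 := by
    rw [twoSidedOp_apply]; simp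
  have h3 := hg u
  rw [← h2, hu, inner_self_eq_zero] at h3
  exact hg0 h3

/-- The range of `D I^β_θ` is the orthogonal complement of a vector. -/
theorem exists_normal_range_twoSidedOp {β θ : ℝ} (hβ0 : 0 < β) (hβ1 : β < 1 / 2)
    (hθ : θ ∈ Icc (0 : ℝ) 1) : ∃ n : L2Unit, ∀ y, (∃ u, twoSidedOp β θ u = y) ↔ inner ℝ n y = 0 := by
  obtain ⟨c, hc, hb⟩ := exists_pos_mul_norm_le_twoSidedOp hβ0 hβ1
  have hcl := isClosed_range_of_mul_norm_le hc (hb θ hθ)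
  set R := LinearMap.range (twoSidedOp β θ).toLinearMap with hR
  have : CompleteSpace R := hcl.completeSpace_coe
  have hne : Rᗮ ≠ ⊥ := by
    intro hbot
    have hs : Function.Surjective (twoSidedOp β θ).toLinearMap := LinearMap.range_eq_top.1 <| by
      rw [← hR, ← Submodule.orthogonal_orthogonal R, hbot, Submodule.bot_orthogonal_eq_top]
    exact not_surjective_twoSidedOp hβ0 hβ1 hθ hs
  -- A mean-zero function is a gradient, and the energy identity excludes nonzero gradients from the
  -- complement. So the mean is injective there, and the complement has dimension at most one.
  have hone : ∀ z ∈ Rᗮ, inner ℝ oneL2 z = 0 → z = 0 := by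
    intro z hz h1
    obtain ⟨v, rfl⟩ := exists_gradOp_eq h1
    rw [eq_zero_of_forall_inner_twoSidedOp (θ := θ) hβ0 hβ1 v fun u =>
      (Submodule.mem_orthogonal R _).1 hz _ ⟨u, rfl⟩, map_zero]
  obtain ⟨n, hn, hn0⟩ := Submodule.exists_mem_ne_zero_of_ne_bot hne
  have hn1 : inner ℝ oneL2 n ≠ 0 := fun h => hn0 (hone n hn h)
  refine ⟨n, fun y => ⟨?_, fun hy => ?_⟩⟩
  · rintro ⟨u, rfl⟩
    rw [real_inner_comm]
    exact (Submodule.mem_orthogonal R _).1 hn _ ⟨u, rfl⟩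
  · have hmem : y ∈ Rᗮᗮ := by
      rw [Submodule.mem_orthogonal]
      intro z hz
      have hz' : z - (inner ℝ oneL2 z / inner ℝ oneL2 n) • n = 0 := by
        refine hone _ (Rᗮ.sub_mem hz (Rᗮ.smul_mem _ hn)) ?_
        rw [inner_sub_right, inner_smul_right, div_mul_cancel₀ _ hn1, sub_self]
      rw [sub_eq_zero.1 hz', inner_smul_left, hy, mul_zero]
    rw [Submodule.orthogonal_orthogonal] at hmem
    exact hmem

/-! ### Bijectivity of the Petrov–Galerkin operator -/

/-- Lax–Milgram for the Dirichlet form; the coercivity constant 1/3 comes from the Poincaré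
inequality. -/
theorem exists_inner_gradOp_eq (f : StrongDual ℝ (H0 1)) : ∃ y, ∀ v, inner ℝ y (gradOp v) = f v := by
  set b : H0 1 →L[ℝ] H0 1 →L[ℝ] ℝ := (innerSL ℝ).bilinearComp gradOp gradOp with hb
  have hbv : ∀ u v, b u v = inner ℝ (gradOp u) (gradOp v) := fun _ _ => rfl
  have hco : IsCoercive b := by
    refine ⟨1 / 3, by norm_num, fun u => ?_⟩
    rw [hbv, real_inner_self_eq_norm_sq]
    nlinarith [norm_sq_le_gradOp u]
  set z := (InnerProductSpace.toDual ℝ (H0 1)).symm f with hz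
  refine ⟨gradOp (hco.continuousLinearEquivOfBilin.symm z), fun v => ?_⟩
  rw [← hbv, ← hco.continuousLinearEquivOfBilin_apply, ContinuousLinearEquiv.apply_symm_apply, hz,
    InnerProductSpace.toDual_symm_apply]

/-- The operator `u ↦ (k D I^β_θ u, D ·)` associated with a bounded operator `k` on `L²(0,1)`. -/
noncomputable def pgOp (β θ : ℝ) (k : L2Unit →L[ℝ] L2Unit) :
    H0 (1 - β) →L[ℝ] H0 1 →L[ℝ] ℝ :=
  (innerSL ℝ).bilinearComp (k.comp (twoSidedOp β θ)) gradOp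

theorem pgOp_apply (β θ : ℝ) (k : L2Unit →L[ℝ] L2Unit) (u : H0 (1 - β)) (v : H0 1) :
    pgOp β θ k u v = inner ℝ (k (twoSidedOp β θ u)) (gradOp v) := rfl

/-- A functional (y, G·) determines y only up to constants. The range of the fractional operator is
a hyperplane, and by hypothesis `k' oneL2` is transversal to it, so exactly one representative y - c
has `k'` of it in the range. -/
theorem bijective_pgOp {β θ : ℝ} (hβ0 : 0 < β) (hβ1 : β < 1 / 2) (hθ : θ ∈ Icc (0 : ℝ) 1)
    (k k' : L2Unit →L[ℝ] L2Unit) (hkk' : ∀ y, k (k' y) = y) (hk'k : ∀ y, k' (k y) = y)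
    (h1 : ∀ u, twoSidedOp β θ u ≠ k' oneL2) : Function.Bijective (pgOp β θ k) := by
  obtain ⟨n, hn⟩ := exists_normal_range_twoSidedOp hβ0 hβ1 hθ
  have hn1 : inner ℝ n (k' oneL2) ≠ 0 := fun h => by
    obtain ⟨u, hu⟩ := (hn _).2 h
    exact h1 u hu
  constructor
  · refine (injective_iff_map_eq_zero _).2 fun u hu => ?_
    obtain ⟨c, hc⟩ := exists_smul_oneL2_of_forall_inner_gradOp
      (y := k (twoSidedOp β θ u)) fun v => by rw [← pgOp_apply, hu]; rfl
    have h2 : twoSidedOp β θ u = c • k' oneL2 := by rw [← hk'k (twoSidedOp β θ u), hc, map_smul]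
    have h3 := (hn _).1 ⟨u, h2⟩
    rw [inner_smul_right] at h3
    have hc0 : c = 0 := (mul_eq_zero.1 h3).resolve_right hn1
    rw [hc0, zero_smul] at h2
    obtain ⟨c', hc', hb⟩ := exists_pos_mul_norm_le_twoSidedOp hβ0 hβ1
    have h4 := hb θ hθ u
    rw [h2, norm_zero] at h4
    exact norm_le_zero_iff.1 (nonpos_of_mul_nonpos_right h4 hc')
  · intro f
    obtain ⟨y, hy⟩ := exists_inner_gradOp_eq f
    obtain ⟨u, hu⟩ := (hn (k' y - (inner ℝ n (k' y) / inner ℝ n (k' oneL2)) • k' oneL2)).2 <| by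
      rw [inner_sub_right, inner_smul_right, div_mul_cancel₀ _ hn1, sub_self]
    refine ⟨u, ContinuousLinearMap.ext fun v => ?_⟩
    rw [pgOp_apply, hu, map_sub, map_smul, hkk', hkk', inner_sub_left, inner_smul_left,
      inner_oneL2_gradOp, mul_zero, sub_zero, hy]

/-! ### Inf-sup conditions from an isomorphism onto the dual -/

section InfSup

variable {E F : Type*} [NormedAddCommGroup E] [NormedSpace ℝ E] [NormedAddCommGroup F]
  [InnerProductSpace ℝ F] (S : E ≃L[ℝ] StrongDual ℝ F)

theorem ContinuousLinearMap.exists_equiv_of_bijective {G : Type*} [NormedAddCommGroup G]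
    [NormedSpace ℝ G] [CompleteSpace E] [CompleteSpace G] (T : E →L[ℝ] G)
    (hT : Function.Bijective T) : ∃ S : E ≃L[ℝ] G, ∀ u, S u = T u :=
  ⟨.ofBijective T (LinearMap.ker_eq_bot.2 hT.1) (LinearMap.range_eq_top.2 hT.2), fun _ => rfl⟩

theorem ContinuousLinearEquiv.le_iInf_iSup_div_norm {κ : ℝ} (hκ0 : 0 ≤ κ)
    (hκ : κ * ‖(S.symm : StrongDual ℝ F →L[ℝ] E)‖ < 1) :
    (κ : EReal) ≤ ⨅ w : {w : E // w ≠ 0}, ⨆ v : {v : F // v ≠ 0},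
      ((S w.1 v.1 / (‖w.1‖ * ‖v.1‖) : ℝ) : EReal) := by
  refine le_iInf fun w => ?_
  by_contra! hlt
  have hw : 0 < ‖w.1‖ := norm_pos_iff.2 w.2
  have h1 : ∀ v : F, S w.1 v ≤ κ * ‖w.1‖ * ‖v‖ := by
    intro v
    rcases eq_or_ne v 0 with rfl | hv
    · simp
    · have h2 : ((S w.1 v / (‖w.1‖ * ‖v‖) : ℝ) : EReal) < κ :=
        lt_of_le_of_lt (le_iSup (fun v : {v : F // v ≠ 0} =>
          ((S w.1 v.1 / (‖w.1‖ * ‖v.1‖) : ℝ) : EReal)) ⟨v, hv⟩) hlt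
      have h3 := (div_lt_iff₀ (mul_pos hw (norm_pos_iff.2 hv))).1 (EReal.coe_lt_coe_iff.1 h2)
      linarith
  have h4 : ‖S w.1‖ ≤ κ * ‖w.1‖ := by
    refine ContinuousLinearMap.opNorm_le_bound _ (by positivity) fun v => ?_
    rw [Real.norm_eq_abs, abs_le]
    -- The supremum carries no absolute value; replacing v by -v supplies the other bound.
    have := h1 (-v)
    rw [(S w.1).map_neg, norm_neg] at this
    exact ⟨by linarith, h1 v⟩
  have h5 : ‖w.1‖ ≤ ‖(S.symm : StrongDual ℝ F →L[ℝ] E)‖ * ‖S w.1‖ := by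
    simpa using (S.symm : StrongDual ℝ F →L[ℝ] E).le_opNorm (S w.1)
  have h6 : ‖w.1‖ ≤ (κ * ‖(S.symm : StrongDual ℝ F →L[ℝ] E)‖) * ‖w.1‖ := by
    calc _ ≤ _ := h5
      _ ≤ ‖(S.symm : StrongDual ℝ F →L[ℝ] E)‖ * (κ * ‖w.1‖) := by gcongr
      _ = _ := by ring
  nlinarith

/-- The witness is the preimage of the functional (v,·), which takes the value ‖v‖² at v. -/
theorem ContinuousLinearEquiv.iSup_apply_pos {v : F} (hv : v ≠ 0) :
    (0 : EReal) < ⨆ w : E, ((S w v : ℝ) : EReal) := by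
  refine lt_of_lt_of_le ?_ (le_iSup (fun w : E => ((S w v : ℝ) : EReal)) (S.symm (innerSL ℝ v)))
  rw [S.apply_symm_apply, innerSL_apply_apply, real_inner_self_eq_norm_sq]
  exact EReal.coe_pos.2 (pow_pos (norm_pos_iff.2 hv) 2)

theorem ContinuousLinearEquiv.exists_infSup : ∃ κ : ℝ, 0 < κ ∧
    (κ : EReal) ≤ (⨅ w : {w : E // w ≠ 0}, ⨆ v : {v : F // v ≠ 0},
      ((S w.1 v.1 / (‖w.1‖ * ‖v.1‖) : ℝ) : EReal)) ∧
    (∀ v : F, v ≠ 0 → (0 : EReal) < ⨆ w : E, ((S w v : ℝ) : EReal)) ∧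
    (∀ f : StrongDual ℝ F, (∃! u : E, ∀ v : F, S u v = f v) ∧
      ∀ u : E, (∀ v : F, S u v = f v) → ‖u‖ ≤ κ⁻¹ * ‖f‖) := by
  set M := ‖(S.symm : StrongDual ℝ F →L[ℝ] E)‖ with hM
  have hM0 : 0 ≤ M := ContinuousLinearMap.opNorm_nonneg _
  have hM1 : 0 < M + 1 := by positivity
  -- With M + 1 in place of M the constant is positive even when M = 0, and κM < 1 holds strictly.
  refine ⟨(M + 1)⁻¹, by positivity, ?_, fun v hv => S.iSup_apply_pos hv, fun f => ⟨?_, ?_⟩⟩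
  · refine S.le_iInf_iSup_div_norm (by positivity) ?_
    rw [inv_mul_lt_iff₀ hM1]
    linarith
  · refine ⟨S.symm f, fun v => by rw [S.apply_symm_apply], fun u hu => ?_⟩
    rw [← ContinuousLinearMap.ext hu, S.symm_apply_apply]
  · intro u hu
    have h1 : S u = f := ContinuousLinearMap.ext hu
    rw [inv_inv, ← S.symm_apply_apply u, h1]
    calc ‖S.symm f‖ ≤ M * ‖f‖ := (S.symm : StrongDual ℝ F →L[ℝ] E).le_opNorm f
      _ ≤ (M + 1) * ‖f‖ := by gcongr; linarith

end InfSup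

/-! ### Nondegeneracy and the conclusion -/

theorem rightInt_one (σ : ℝ) (w : ℝ → ℝ) : rightInt σ w 1 = 0 := by simp [rightInt]

/-- The function with constant flux `e = 1 / K`, normalised to the boundary values `1` and `0`. -/
theorem isLeftHarmonic_of_flux {K : ℝ → ℝ} {e : L2Unit}
    (he : ∀ᵐ x ∂(volume.restrict (Ioo (0 : ℝ) 1)), K x * e x = 1) {a : ℝ} (ha0 : a ≠ 0)
    (ha : ∫ t in (0 : ℝ)..1, e t = a) :
    IsLeftHarmonic K fun x => 1 + ∫ t in (0 : ℝ)..x, (-a⁻¹ • e : L2Unit) t := by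
  set g : L2Unit := -a⁻¹ • e with hg
  have hge : (g : ℝ → ℝ) =ᵐ[volume.restrict (Ioo (0 : ℝ) 1)] fun x => -a⁻¹ * e x :=
    Lp.coeFn_smul (-a⁻¹) e
  have hprim : ∀ x ∈ Ioo (0 : ℝ) 1, (1 + ∫ t in (0 : ℝ)..x, g t) = 1 + ∫ t in (0 : ℝ)..x, g t :=
    fun _ _ => rfl
  refine ⟨memH1_of_primitive g hprim, ?_, by simp, ?_, fun v => ?_⟩
  · have hi : IntervalIntegrable g volume 0 1 := g.intervalIntegrable (by simp) (by simp)
    have := (hi.absolutelyContinuousOnInterval_intervalIntegral (c := 0) (by simp)).continuousOn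
    rw [uIcc_of_le zero_le_one] at this
    exact continuousOn_const.add this
  · rw [intervalIntegral_congr_of_ae_restrict le_rfl zero_le_one le_rfl hge,
      intervalIntegral.integral_const_mul, ha, neg_mul, inv_mul_cancel₀ ha0, add_neg_cancel]
  · have h1 : ∫ x in Ioo (0 : ℝ) 1, gradOp v x = 0 := by
      have h := inner_oneL2_gradOp v
      rw [inner_eq_integral_of_ae coeFn_oneL2 ae_eq_rfl] at h
      simpa using h
    have h2 := (hasWeakDeriv_of_primitive g.integrableOn hprim).weakDeriv_ae_eq
    have h3 : ∀ᵐ x ∂(volume.restrict (Ioo (0 : ℝ) 1)),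
        K x * weakDeriv (fun x => 1 + ∫ t in (0 : ℝ)..x, g t) x * weakDeriv v.fn x
          = -a⁻¹ * gradOp v x := by
      filter_upwards [h2, hge, he, weakDeriv_fn_ae_eq v] with x p q r s
      rw [p, q, s, gradOp_apply]
      linear_combination (-a⁻¹ * derivOp 0 1 v.1 x) * r
    rw [integral_congr_ae h3, integral_const_mul, h1, mul_zero]

/-- Here e = 1/K. If e = D I^β_θ u and a = ∫ e, then -u/a has D I^β_θ equal to the derivative of the
left harmonic function w_l. Evaluating at x = 1, where w_l and the right integral vanish, gives 1 +
θ(I_l u_l)(1) - (1-θ)(I_r u_l)(0) = 0 for u_l = -u/a. This relation is also what turns the primitive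
formula into the corrector equation, so nondegeneracy is contradicted. -/
theorem twoSidedOp_ne_of_nondegenerate {K : ℝ → ℝ} {β θ : ℝ} (hβ0 : 0 < β) (hβ1 : β < 1 / 2)
    (hV : Nondegenerate K β θ) {e : L2Unit}
    (he : ∀ᵐ x ∂(volume.restrict (Ioo (0 : ℝ) 1)), K x * e x = 1)
    (hpos : ∫ t in (0 : ℝ)..1, e t ≠ 0) (u : H0 (1 - β)) : twoSidedOp β θ u ≠ e := by
  intro hu
  set a := ∫ t in (0 : ℝ)..1, e t with ha
  have hw := isLeftHarmonic_of_flux he hpos rfl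
  set ul : H0 (1 - β) := -a⁻¹ • u with hul
  have hI : ∀ x ∈ Icc (0 : ℝ) 1, twoSidedInt β θ ul.fn x
      = (1 - θ) * rightInt β ul.fn 0 + ∫ t in (0 : ℝ)..x, (-a⁻¹ • e : L2Unit) t := by
    intro x hx
    rw [twoSidedInt_eq hβ0 hβ1 θ ul hx, hul, map_smul, hu]
  have h1 := hI 1 (by simp)
  have h2 := hw.at_one
  rw [twoSidedInt, rightInt_one] at h1
  refine hV _ ul hw (fun x hx => ?_) (by linarith)
  rw [hI x hx]
  linear_combination (-x) * h1 - x * h2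

theorem integral_ne_zero_of_mul_eq_one {K : ℝ → ℝ} {e : L2Unit}
    (hK : ∀ᵐ x ∂(volume.restrict (Ioo (0 : ℝ) 1)), 0 < K x)
    (he : ∀ᵐ x ∂(volume.restrict (Ioo (0 : ℝ) 1)), K x * e x = 1) :
    ∫ t in (0 : ℝ)..1, e t ≠ 0 := by
  rw [intervalIntegral.integral_of_le zero_le_one, integral_Ioc_eq_integral_Ioo]
  refine ((integral_pos_iff_support_of_nonneg_ae ?_ (L2Unit.integrableOn _)).2 ?_).ne'
  · filter_upwards [hK, he] with x hx p
    exact (pos_of_mul_pos_right (p.symm ▸ one_pos : 0 < K x * e x) hx.le).le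
  · rw [pos_iff_ne_zero]
    intro h0
    have h1 : ∀ᵐ x ∂(volume.restrict (Ioo (0 : ℝ) 1)), False := by
      filter_upwards [measure_eq_zero_iff_ae_notMem.1 h0, he] with x p q
      rw [Function.mem_support, not_not] at p
      simp [p] at q
    rw [eventually_false_iff_eq_bot, ae_eq_bot, Measure.restrict_eq_zero] at h1
    simp at h1

theorem pgForm_eq_pgOp {β : ℝ} (hβ0 : 0 < β) (hβ1 : β < 1 / 2) (θ : ℝ) {K : ℝ → ℝ}
    {k : L2Unit →L[ℝ] L2Unit}
    (hk : ∀ y : L2Unit, k y =ᵐ[volume.restrict (Ioo (0 : ℝ) 1)] fun x => K x * y x)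
    (u : H0 (1 - β)) (v : H0 1) : pgForm K β θ u v = pgOp β θ k u v := by
  rw [pgOp_apply, inner_eq_integral_of_ae ae_eq_rfl ae_eq_rfl, pgForm]
  refine integral_congr_ae ?_
  filter_upwards [hk (twoSidedOp β θ u), weakDeriv_twoSidedInt_ae_eq hβ0 hβ1 θ u,
    weakDeriv_fn_ae_eq v] with x p q r
  rw [p, q, r, gradOp_apply]

/-- The form `A` induces an isomorphism of `H^{1-β}_0(0,1)` onto the dual of `H^1_0(0,1)`. -/
theorem exists_equiv_eq_pgForm {β θ : ℝ} (hβ0 : 0 < β) (hβ1 : β < 1 / 2)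
    (hθ : θ ∈ Icc (0 : ℝ) 1)
    {K : ℝ → ℝ} (hK : AEMeasurable K (volume.restrict (Ioo (0 : ℝ) 1))) {Km KM : ℝ} (hKm : 0 < Km)
    (hKb : ∀ᵐ x ∂(volume.restrict (Ioo (0 : ℝ) 1)), Km ≤ K x ∧ K x ≤ KM)
    (hV : Nondegenerate K β θ) :
    ∃ S : H0 (1 - β) ≃L[ℝ] StrongDual ℝ (H0 1), ∀ u v, S u v = pgForm K β θ u v := by
  have hK1 : ∀ᵐ x ∂(volume.restrict (Ioo (0 : ℝ) 1)), ‖K x‖ ≤ KM := by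
    filter_upwards [hKb] with x hx
    rw [Real.norm_of_nonneg (hKm.le.trans hx.1)]
    exact hx.2
  have hK2 : ∀ᵐ x ∂(volume.restrict (Ioo (0 : ℝ) 1)), ‖(K x)⁻¹‖ ≤ Km⁻¹ := by
    filter_upwards [hKb] with x hx
    rw [norm_inv, Real.norm_of_nonneg (hKm.le.trans hx.1)]
    exact inv_anti₀ hKm hx.1
  have hKi : AEStronglyMeasurable (fun x => (K x)⁻¹) (volume.restrict (Ioo (0 : ℝ) 1)) :=
    hK.inv.aestronglyMeasurable
  obtain ⟨k, hk⟩ : ∃ k : L2Unit →L[ℝ] L2Unit, ∀ y : L2Unit,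
      k y =ᵐ[volume.restrict (Ioo (0 : ℝ) 1)] fun x => K x * y x :=
    ⟨_, coeFn_mulLp hK.aestronglyMeasurable hK1⟩
  obtain ⟨k', hk'⟩ : ∃ k' : L2Unit →L[ℝ] L2Unit, ∀ y : L2Unit,
      k' y =ᵐ[volume.restrict (Ioo (0 : ℝ) 1)] fun x => (K x)⁻¹ * y x :=
    ⟨_, coeFn_mulLp hKi hK2⟩
  have hkk' : ∀ y, k (k' y) = y := fun y => Lp.ext <| by
    filter_upwards [hk (k' y), hk' y, hKb] with x p q hx
    rw [p, q, mul_inv_cancel_left₀ (hKm.trans_le hx.1).ne']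
  have hk'k : ∀ y, k' (k y) = y := fun y => Lp.ext <| by
    filter_upwards [hk' (k y), hk y, hKb] with x p q hx
    rw [p, q, inv_mul_cancel_left₀ (hKm.trans_le hx.1).ne']
  have he : ∀ᵐ x ∂(volume.restrict (Ioo (0 : ℝ) 1)), K x * k' oneL2 x = 1 := by
    filter_upwards [hk' oneL2, coeFn_oneL2, hKb] with x p q hx
    rw [p, q, mul_one, mul_inv_cancel₀ (hKm.trans_le hx.1).ne']
  have hpos := integral_ne_zero_of_mul_eq_one (hKb.mono fun x hx => hKm.trans_le hx.1) he
  have hbij := bijective_pgOp hβ0 hβ1 hθ k k' hkk' hk'k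
    (twoSidedOp_ne_of_nondegenerate hβ0 hβ1 hV he hpos)
  obtain ⟨S, hS⟩ := ContinuousLinearMap.exists_equiv_of_bijective (E := H0 (1 - β))
    (G := StrongDual ℝ (H0 1)) (pgOp β θ k) hbij
  exact ⟨S, fun u v => (congrArg (fun f : StrongDual ℝ (H0 1) => f v) (hS u)).trans
    (pgForm_eq_pgOp hβ0 hβ1 θ hk u v).symm⟩

theorem theorem6p4 (β θ : ℝ) (hβ0 : 0 < β) (hβ1 : β < 1 / 2) (hθ0 : 0 ≤ θ) (hθ1 : θ ≤ 1)
    (K : ℝ → ℝ) (hK : AEMeasurable K (volume.restrict (Ioo (0 : ℝ) 1)))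
    (Km KM : ℝ) (hKm : 0 < Km)
    (hKb : ∀ᵐ x ∂(volume.restrict (Ioo (0 : ℝ) 1)), Km ≤ K x ∧ K x ≤ KM)
    (hV : Nondegenerate K β θ) :
    -- the form is well defined: `D I^β_θ u` and `D v` are in `L²(0,1)`
    (∀ u : H0 (1 - β), MemH1 (twoSidedInt β θ u.fn)) ∧ (∀ v : H0 1, MemH1 v.fn) ∧
    -- it is bilinear and bounded
    IsBoundedBilinearMap ℝ (fun p : H0 (1 - β) × H0 1 => pgForm K β θ p.1 p.2) ∧
    ∃ κ : ℝ, 0 < κ ∧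
      -- weak coercivity
      (κ : EReal) ≤ (⨅ w : {w : H0 (1 - β) // w ≠ 0}, ⨆ v : {v : H0 1 // v ≠ 0},
        ((pgForm K β θ w.1 v.1 / (‖w.1‖ * ‖v.1‖) : ℝ) : EReal)) ∧
      (∀ v : H0 1, v ≠ 0 → (0 : EReal) < ⨆ w : H0 (1 - β), ((pgForm K β θ w v : ℝ) : EReal)) ∧
      -- well-posedness, for `f` in the dual of `H^1_0(0,1)` with the dual norm
      (∀ f : StrongDual ℝ (H0 1),
        (∃! u : H0 (1 - β), ∀ v : H0 1, pgForm K β θ u v = f v) ∧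
        ∀ u : H0 (1 - β), (∀ v : H0 1, pgForm K β θ u v = f v) → ‖u‖ ≤ κ⁻¹ * ‖f‖) := by
  obtain ⟨S, hS⟩ := exists_equiv_eq_pgForm hβ0 hβ1 ⟨hθ0, hθ1⟩ hK hKm hKb hV
  simp only [← hS]
  refine ⟨memH1_twoSidedInt hβ0 hβ1 θ, memH1_fn,
    (S : H0 (1 - β) →L[ℝ] StrongDual ℝ (H0 1)).isBoundedBilinearMap, S.exists_infSup⟩
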